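/- Let $V$ be a right $\mathbb{H}$-module of finite dimension $n=\dim_{\mathbb H}V$. For a right $\mathbb{H}$-module $W$ of dimension $n$ let $\bar W$ be the left module with the same vectors and $q\cdot w:=w\cdot\bar q$, let $\sigma(x\otimes y)=y\otimes x$ on $W\otimes_{\mathbb H}\bar W$, and put $S^k(W)=\mathrm{Sym}^k_{\mathbb R}\big((W\otimes_{\mathbb H}\bar W)^\sigma\big)$. The space $S^n(W)$ has a unique $\mathrm{Aut}_{\mathbb H}(W)$-invariant subspace of real codimension $1$; let $M$ be the quotient map by it, let $L^k(W)=\{x\in S^k(W): M(xy)=0\ \forall y\in S^{n-k}(W)\}$ and $R^k(W)=S^k(W)/L^k(W)$ for $0\le k\le n$. Put $\Omega^{k,k}(V)=R^k(\overline{V^*})$, where $V^*=\mathrm{Hom}_{\mathbb H}(V,\mathbb H)$ and $\overline{V^*}$ is the right module $\varphi\cdot q:=\bar q\varphi$; these spaces carry the product induced by the symmetric algebra and are contravariant in $V$. For an $\mathbb H$-basis of $V$ with coordinates $\varphi_1,\dots,\varphi_n$, a hyperhermitian matrix $A=(a_{ij})$ (i.e. $a_{ij}=\overline{a_{ji}}$)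 defines the class $[A]\in\Omega^{1,1}(V)$ of $\sum_{i,j}\varphi_i\otimes a_{ij}\varphi_j$, which corresponds to the form $\sum_{i,j}\bar x_ia_{ij}y_j$. The half line $\Omega^{n,n}(V)_{\ge0}$ consists of the non-negative multiples of $[\mathrm{Id}]^n$ (it does not depend on the basis). An element of $\Omega^{k,k}(V)$ is strongly positive if it is a finite sum of elements $f^*\xi$ with $f:V\to U$ a morphism of right $\mathbb H$-modules, $\dim_{\mathbb H}U=k$, $\xi\in\Omega^{k,k}(U)_{\ge0}$; an element $\eta\in\Omega^{k,k}(V)$ is weakly positive if $\eta\cdot\zeta\in\Omega^{n,n}(V)_{\ge0}$ for every strongly positive $\zeta\in\Omega^{n-k,n-k}(V)$. Let $C^k(V)$ and $K^k(V)$ be the sets of strongly and of weakly positive elements of $\Omega^{k,k}(V)$. Let $\mathcal H_n$ be the real vector space of hyperhermitian $n\times n$ matrices, $\mathcal C\subset\mathcal H_n$ the cone of non-negative definite ones ($\xi^*A\xi\ge0$ for all $\xi\in\mathbb H^n$), and $(X,Y)=\mathrm{Re}\sum_i(XY)_{ii}$ on $\mathcal H_n$. 1. For each $k\in\{0,1,n-1,n\}$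 with $0\le k\le n$ one has $K^k(V)=C^k(V)$. 2. The cone $\mathcal C$ is self-dual: $\mathcal C=\{X\in\mathcal H_n:\ (X,Y)\ge0\ \ \forall Y\in\mathcal C\}$. 3. If $n\ge1$, then for every $\mathbb H$-basis of $V$ the map $A\mapsto[A]$ is a bijection $\mathcal H_n\to\Omega^{1,1}(V)$ that takes $\mathcal C$ onto $C^1(V)=K^1(V)$. 4. If $n\ge1$, then for every $\mathbb H$-basis of $V$ there are linear isomorphisms $\tau:\Omega^{n,n}(V)\to\mathbb R$ with $\tau([\mathrm{Id}]^n)=1$ and $\Psi:\Omega^{n-1,n-1}(V)\to\mathcal H_n$ with $\tau(\eta\cdot[X])=(\Psi(\eta),X)$ for all $\eta\in\Omega^{n-1,n-1}(V)$ and $X\in\mathcal H_n$, and $\Psi$ takes $C^{n-1}(V)=K^{n-1}(V)$ onto $\mathcal C$. -/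

import Mathlib

open scoped TensorProduct Quaternion
open MulOpposite

universe u v

noncomputable section

namespace QuatForms

/-! A right `ℍ`-module is a module over `ℍ[ℝ]ᵐᵒᵖ`: the vector `w · q` is `op q • w`. -/

/-! ### The tensor product `W ⊗_ℍ W̄` and the algebra `R(W)` -/

section Tensor

variable (W : Type u) [AddCommGroup W] [Module ℝ W] [Module ℍ[ℝ]ᵐᵒᵖ W]

/-- The relations `(w · q) ⊗ w' = w ⊗ (q · w')` of `W ⊗_ℍ W̄`. Here `W̄` is the left module with
the same vectors as `W` and the scalar multiplication `q · w' := w' · q̄`. -/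
def balancedRel : Submodule ℝ (W ⊗[ℝ] W) :=
  Submodule.span ℝ
    {t | ∃ (w w' : W) (q : ℍ[ℝ]), t = (op q • w) ⊗ₜ[ℝ] w' - w ⊗ₜ[ℝ] (op (star q) • w')}

/-- `W ⊗_ℍ W̄`, as a real vector space. -/
abbrev TensorConj : Type u := (W ⊗[ℝ] W) ⧸ balancedRel W

theorem balancedRel_le_comap_comm :
    balancedRel W ≤ (balancedRel W).comap (TensorProduct.comm ℝ W W).toLinearMap := by
  refine Submodule.span_le.2 ?_
  rintro _ ⟨w, w', q, rfl⟩
  have h : (op (star q) • w') ⊗ₜ[ℝ] w - w' ⊗ₜ[ℝ] (op (star (star q)) • w) ∈ balancedRel W :=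
    Submodule.subset_span ⟨w', w, star q, rfl⟩
  rw [star_star] at h
  have h' := (balancedRel W).neg_mem h
  simpa using h'

/-- The involution `σ (x ⊗ y) = y ⊗ x` of `W ⊗_ℍ W̄`. -/
def sigma : TensorConj W →ₗ[ℝ] TensorConj W :=
  (balancedRel W).mapQ (balancedRel W) (TensorProduct.comm ℝ W W).toLinearMap
    (balancedRel_le_comap_comm W)

/-- The fixed subspace `(W ⊗_ℍ W̄)^σ`. -/
def sigmaFixed : Submodule ℝ (TensorConj W) := LinearMap.eqLocus (sigma W) LinearMap.id

/-- `Sym^• ((W ⊗_ℍ W̄)^σ)`. -/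
abbrev SymAlg : Type u := SymmetricAlgebra ℝ (sigmaFixed W)

/-- `Sym^k ((W ⊗_ℍ W̄)^σ)`, the homogeneous part of degree `k`. -/
def symPow (k : ℕ) : Submodule ℝ (SymAlg W) :=
  LinearMap.range (SymmetricAlgebra.ι ℝ (sigmaFixed W)) ^ k

end Tensor

/-! ### Functoriality in `W` -/

section Functor

variable {W₁ : Type u} [AddCommGroup W₁] [Module ℝ W₁] [Module ℍ[ℝ]ᵐᵒᵖ W₁]
  [IsScalarTower ℝ ℍ[ℝ]ᵐᵒᵖ W₁]
  {W₂ : Type v} [AddCommGroup W₂] [Module ℝ W₂] [Module ℍ[ℝ]ᵐᵒᵖ W₂]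
  [IsScalarTower ℝ ℍ[ℝ]ᵐᵒᵖ W₂]

theorem balancedRel_le_comap_map (f : W₁ →ₗ[ℍ[ℝ]ᵐᵒᵖ] W₂) :
    balancedRel W₁ ≤ (balancedRel W₂).comap
      (TensorProduct.map (f.restrictScalars ℝ) (f.restrictScalars ℝ)) := by
  refine Submodule.span_le.2 ?_
  rintro _ ⟨w, w', q, rfl⟩
  have h : (op q • f w) ⊗ₜ[ℝ] f w' - f w ⊗ₜ[ℝ] (op (star q) • f w') ∈ balancedRel W₂ :=
    Submodule.subset_span ⟨f w, f w', q, rfl⟩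
  simpa using h

/-- The map `x ⊗ y ↦ f x ⊗ f y`. -/
def tensorMap (f : W₁ →ₗ[ℍ[ℝ]ᵐᵒᵖ] W₂) : TensorConj W₁ →ₗ[ℝ] TensorConj W₂ :=
  (balancedRel W₁).mapQ (balancedRel W₂)
    (TensorProduct.map (f.restrictScalars ℝ) (f.restrictScalars ℝ)) (balancedRel_le_comap_map f)

theorem sigma_tensorMap (f : W₁ →ₗ[ℍ[ℝ]ᵐᵒᵖ] W₂) (t : TensorConj W₁) :
    sigma W₂ (tensorMap f t) = tensorMap f (sigma W₁ t) := by
  obtain ⟨t, rfl⟩ := Submodule.Quotient.mk_surjective _ t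
  simp only [sigma, tensorMap, Submodule.mapQ_apply, LinearEquiv.coe_coe]
  congr 1
  induction t using TensorProduct.induction_on with
  | zero => simp
  | tmul x y => simp
  | add x y hx hy => simp only [map_add, hx, hy]

/-- The map induced on the `σ`-fixed parts. -/
def sigmaFixedMap (f : W₁ →ₗ[ℍ[ℝ]ᵐᵒᵖ] W₂) : sigmaFixed W₁ →ₗ[ℝ] sigmaFixed W₂ :=
  (tensorMap f).restrict fun t ht => by
    have ht' : sigma W₁ t = t := ht
    change sigma W₂ (tensorMap f t) = tensorMap f t
    rw [sigma_tensorMap, ht']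

/-- The induced homomorphism of symmetric algebras. -/
def symAlgMap (f : W₁ →ₗ[ℍ[ℝ]ᵐᵒᵖ] W₂) : SymAlg W₁ →ₐ[ℝ] SymAlg W₂ :=
  SymmetricAlgebra.lift (SymmetricAlgebra.ι ℝ (sigmaFixed W₂) ∘ₗ sigmaFixedMap f)

theorem symAlgMap_mem (f : W₁ →ₗ[ℍ[ℝ]ᵐᵒᵖ] W₂) (k : ℕ) {x : SymAlg W₁} (hx : x ∈ symPow W₁ k) :
    symAlgMap f x ∈ symPow W₂ k := by
  have h : (symPow W₁ k).map (symAlgMap f).toLinearMap ≤ symPow W₂ k := by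
    rw [symPow, symPow, Submodule.map_pow]
    refine pow_le_pow_left' ?_ k
    rintro _ ⟨_, ⟨t, rfl⟩, rfl⟩
    exact ⟨sigmaFixedMap f t, by simp [symAlgMap]⟩
  exact h ⟨x, hx, rfl⟩

/-- The induced map on `Sym^k`. -/
def symPowMap (f : W₁ →ₗ[ℍ[ℝ]ᵐᵒᵖ] W₂) (k : ℕ) : symPow W₁ k →ₗ[ℝ] symPow W₂ k :=
  (symAlgMap f).toLinearMap.restrict fun _ hx => symAlgMap_mem f k hx

end Functor

/-! ### The Moore map and the spaces `R^k(W)` -/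

section Moore

variable (W : Type u) [AddCommGroup W] [Module ℝ W] [Module ℍ[ℝ]ᵐᵒᵖ W]
  [IsScalarTower ℝ ℍ[ℝ]ᵐᵒᵖ W]

/-- `N` is an `Aut_ℍ W`-invariant subspace of real codimension one in `Sym^n ((W ⊗_ℍ W̄)^σ)`. -/
def IsInvariantHyperplane (n : ℕ) (N : Submodule ℝ (symPow W n)) : Prop :=
  (∀ g : W ≃ₗ[ℍ[ℝ]ᵐᵒᵖ] W, ∀ x ∈ N, symPowMap g.toLinearMap n x ∈ N) ∧
    Module.finrank ℝ (symPow W n ⧸ N) = 1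

/-- The kernel of the Moore map `Sym^n ((W ⊗_ℍ W̄)^σ) → M(W)`. For `n = dim_ℍ W` there is exactly
one invariant hyperplane, so that the infimum is this hyperplane. -/
def mooreKernel (n : ℕ) : Submodule ℝ (symPow W n) :=
  sInf {N | IsInvariantHyperplane W n N}

variable {W} in
/-- The product `Sym^k × Sym^l → Sym^{k+l}`. -/
def symMul {k l : ℕ} (x : symPow W k) (y : symPow W l) : symPow W (k + l) :=
  ⟨x.1 * y.1, by
    have h := Submodule.mul_mem_mul x.2 y.2
    unfold symPow at h ⊢
    rwa [← pow_add] at h⟩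

/-- `L^k(W)`: the `x ∈ Sym^k` with `M (x · y) = 0` for all `y ∈ Sym^{n-k}`, `n = dim_ℍ W`.
(For `k > n` this is all of `Sym^k`.) -/
def leftKernel (k : ℕ) : Submodule ℝ (symPow W k) where
  carrier := {x | ∀ l : ℕ, k + l = Module.finrank ℍ[ℝ]ᵐᵒᵖ W → ∀ y : symPow W l,
    symMul x y ∈ mooreKernel W (k + l)}
  zero_mem' := fun l _ y => by
    have h : symMul (0 : symPow W k) y = 0 := Subtype.ext (by simp [symMul])
    rw [h]
    exact zero_mem _
  add_mem' := fun {a b} ha hb l hl y => by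
    have h : symMul (a + b) y = symMul a y + symMul b y :=
      Subtype.ext (by simp [symMul, add_mul])
    rw [h]
    exact add_mem (ha l hl y) (hb l hl y)
  smul_mem' := fun c a ha l hl y => by
    have h : symMul (c • a) y = c • symMul a y := Subtype.ext (by simp [symMul])
    rw [h]
    exact Submodule.smul_mem _ c (ha l hl y)

/-- `R^k(W) = Sym^k ((W ⊗_ℍ W̄)^σ) / L^k(W)`. -/
abbrev RSpace (k : ℕ) : Type u := symPow W k ⧸ leftKernel W k

theorem symMul_mem_leftKernel {k l : ℕ} {x : symPow W k} (hx : x ∈ leftKernel W k)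
    (y : symPow W l) : symMul x y ∈ leftKernel W (k + l) := by
  intro m hm z
  have h := hx (l + m) (by omega) (symMul y z)
  have key : ∀ (p q : ℕ) (_ : p = q) (s : symPow W p) (t : symPow W q), s.1 = t.1 →
      s ∈ mooreKernel W p → t ∈ mooreKernel W q := by
    rintro p q rfl s t hst hs
    rwa [← Subtype.ext hst]
  exact key _ _ (by omega) _ _ (by simp [symMul, mul_assoc]) h

theorem symMul_mem_leftKernel' {k l : ℕ} (x : symPow W k) {y : symPow W l}
    (hy : y ∈ leftKernel W l) : symMul x y ∈ leftKernel W (k + l) := by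
  have key : ∀ (p q : ℕ) (_ : p = q) (s : symPow W p) (t : symPow W q), s.1 = t.1 →
      s ∈ leftKernel W p → t ∈ leftKernel W q := by
    rintro p q rfl s t hst hs
    rwa [← Subtype.ext hst]
  exact key _ _ (by omega) _ _ (by simp [symMul, mul_comm]) (symMul_mem_leftKernel W hy x)

variable {W} in
/-- The product `R^k(W) × R^l(W) → R^{k+l}(W)`. -/
def RSpace.mul {k l : ℕ} (x : RSpace W k) (y : RSpace W l) : RSpace W (k + l) :=
  Quotient.map₂ (sc := (leftKernel W (k + l)).quotientRel) symMul (by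
    intro a a' ha b b' hb
    have ha := (Submodule.quotientRel_def _).1 ha
    have hb := (Submodule.quotientRel_def _).1 hb
    refine (Submodule.quotientRel_def _).2 ?_
    have h : symMul a b - symMul a' b' = symMul (a - a') b + symMul a' (b - b') :=
      Subtype.ext (by simp [symMul, sub_mul, mul_sub])
    rw [h]
    exact add_mem (symMul_mem_leftKernel W ha b) (symMul_mem_leftKernel' W a' hb)) x y

end Moore

/-! ### The spaces `Ω^{k,k}(V)` -/

/-- The right `ℍ`-module conjugate to the left `ℍ`-module `V^* = Hom_ℍ(V, ℍ)`. -/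
def ConjDual (V : Type u) [AddCommGroup V] [Module ℍ[ℝ]ᵐᵒᵖ V] : Type u :=
  V →ₗ[ℍ[ℝ]ᵐᵒᵖ] ℍ[ℝ]

section Forms

variable (V : Type u) [AddCommGroup V] [Module ℍ[ℝ]ᵐᵒᵖ V]

instance : AddCommGroup (ConjDual V) :=
  inferInstanceAs (AddCommGroup (V →ₗ[ℍ[ℝ]ᵐᵒᵖ] ℍ[ℝ]))

instance : Module ℝ (ConjDual V) :=
  inferInstanceAs (Module ℝ (V →ₗ[ℍ[ℝ]ᵐᵒᵖ] ℍ[ℝ]))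

/-- The left multiplication `(q φ)(v) = q φ(v)` on `V^*`. -/
def leftSMul {V : Type u} [AddCommGroup V] [Module ℍ[ℝ]ᵐᵒᵖ V] (q : ℍ[ℝ]) (φ : ConjDual V) :
    ConjDual V :=
  (q • (show V →ₗ[ℍ[ℝ]ᵐᵒᵖ] ℍ[ℝ] from φ) : V →ₗ[ℍ[ℝ]ᵐᵒᵖ] ℍ[ℝ])

/-- The right module structure of the conjugate space: `φ · q := q̄ φ`. -/
instance : Module ℍ[ℝ]ᵐᵒᵖ (ConjDual V) where
  smul q φ := leftSMul (star (unop q)) φ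
  one_smul φ := by
    refine LinearMap.ext fun v => ?_
    change star (1 : ℍ[ℝ]) * _ = _
    rw [star_one, one_mul]
  mul_smul p q φ := by
    refine LinearMap.ext fun v => ?_
    change star (unop q * unop p) * _ = star (unop p) * (star (unop q) * _)
    rw [star_mul, mul_assoc]
  smul_zero q := by
    refine LinearMap.ext fun v => ?_
    change star (unop q) * (0 : ℍ[ℝ]) = 0
    rw [mul_zero]
  smul_add q φ ψ := by
    refine LinearMap.ext fun v => ?_
    exact mul_add _ _ _
  add_smul p q φ := by
    refine LinearMap.ext fun v => ?_
    change star (unop p + unop q) * _ = _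
    rw [star_add]
    exact add_mul _ _ _
  zero_smul φ := by
    refine LinearMap.ext fun v => ?_
    change star (0 : ℍ[ℝ]) * _ = (0 : ℍ[ℝ])
    rw [star_zero, zero_mul]

instance : IsScalarTower ℝ ℍ[ℝ]ᵐᵒᵖ (ConjDual V) where
  smul_assoc r q φ := by
    refine LinearMap.ext fun v => ?_
    change star (r • unop q) * _ = r • (star (unop q) * _)
    rw [Quaternion.star_smul, smul_mul_assoc]

/-- `Ω^{k,k}(V) = R^k` of the conjugate dual of `V`. -/
abbrev Omega (k : ℕ) : Type u := RSpace (ConjDual V) k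

/-- The class in `Ω^{k,k}(V)` of an element of `Sym^k`. -/
def Omega.mk {V : Type u} [AddCommGroup V] [Module ℍ[ℝ]ᵐᵒᵖ V] (k : ℕ) :
    symPow (ConjDual V) k →ₗ[ℝ] Omega V k :=
  (leftKernel (ConjDual V) k).mkQ

variable {V} {U : Type v} [AddCommGroup U] [Module ℍ[ℝ]ᵐᵒᵖ U]

/-- The transpose `φ ↦ φ ∘ f` of a morphism `f : V → U`. -/
def conjDualMap (f : V →ₗ[ℍ[ℝ]ᵐᵒᵖ] U) : ConjDual U →ₗ[ℍ[ℝ]ᵐᵒᵖ] ConjDual V where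
  toFun φ := LinearMap.comp (show U →ₗ[ℍ[ℝ]ᵐᵒᵖ] ℍ[ℝ] from φ) f
  map_add' _ _ := rfl
  map_smul' _ _ := rfl

/-- `η = f^* ξ` for `f : V → U`, `ξ ∈ Ω^{k,k}(U)`, `η ∈ Ω^{k,k}(V)`: the map that `f` induces
from `Sym^k` of `U` to `Sym^k` of `V` takes a representative of `ξ` to a representative of `η`. -/
def IsPullback (f : V →ₗ[ℍ[ℝ]ᵐᵒᵖ] U) (k : ℕ) (ξ : Omega U k) (η : Omega V k) : Prop :=
  ∃ x : symPow (ConjDual U) k,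
    Omega.mk k x = ξ ∧ Omega.mk k (symPowMap (conjDualMap f) k x) = η

end Forms

/-! ### Hyperhermitian matrices -/

/-- The real vector space `ℋ_n` of hyperhermitian matrices: `a_{ij}` is the conjugate of
`a_{ji}`. -/
def HypHerm (n : ℕ) : Submodule ℝ (Matrix (Fin n) (Fin n) ℍ[ℝ]) where
  carrier := {A | ∀ i j, A i j = star (A j i)}
  zero_mem' := fun i j => by simp
  add_mem' := fun {A B} hA hB i j => by
    rw [Matrix.add_apply, Matrix.add_apply, star_add, ← hA i j, ← hB i j]
  smul_mem' := fun c A hA i j => by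
    rw [Matrix.smul_apply, Matrix.smul_apply, Quaternion.star_smul, ← hA i j]

/-- The identity matrix. -/
def HypHerm.id (n : ℕ) : HypHerm n := 
  ⟨1, fun i j => by
    rcases eq_or_ne i j with rfl | h
    · simp
    · simp [Matrix.one_apply_ne h, Matrix.one_apply_ne h.symm]⟩

/-- The cone of non-negative definite hyperhermitian matrices: `ξ^* A ξ` is a real number `≥ 0`
for every column `ξ`. -/
def nonnegCone (n : ℕ) : Set (HypHerm n) :=
  {A | ∀ ξ : Fin n → ℍ[ℝ], ∃ r : ℝ, 0 ≤ r ∧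
    ∑ i, ∑ j, star (ξ i) * A.1 i j * ξ j = (r : ℍ[ℝ])}

/-- `Tr (X · Y) = Re ∑ i, (X Y)_{ii}`. -/
def traceForm {n : ℕ} (X Y : HypHerm n) : ℝ := (∑ i, (X.1 * Y.1) i i).re

section Matrices

variable {V : Type u} [AddCommGroup V] [Module ℍ[ℝ]ᵐᵒᵖ V] {n : ℕ}

/-- The `i`-th coordinate `v = ∑ i, e_i · q_i ↦ q_i` with respect to a basis. -/
def coordForm (b : Module.Basis (Fin n) ℍ[ℝ]ᵐᵒᵖ V) (i : Fin n) : ConjDual V where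
  toFun v := unop (b.repr v i)
  map_add' x y := by simp
  map_smul' c x := by simp [MulOpposite.smul_eq_mul_unop]

/-- The element `∑ φ_i ⊗ a_{ij} φ_j` of `(W ⊗_ℍ W̄)^σ` (`W` the conjugate dual of `V`, `φ_i` the
coordinates) that corresponds to the hyperhermitian form `B(x, y) = ∑ x̄_i a_{ij} y_j`. -/
def matrixForm (b : Module.Basis (Fin n) ℍ[ℝ]ᵐᵒᵖ V) :
    HypHerm n →ₗ[ℝ] sigmaFixed (ConjDual V) where
  toFun A := ⟨(balancedRel (ConjDual V)).mkQ
      (∑ i, ∑ j, coordForm b i ⊗ₜ[ℝ] leftSMul (A.1 i j) (coordForm b j)), by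
    suffices h : sigma (ConjDual V) ((balancedRel (ConjDual V)).mkQ
        (∑ i, ∑ j, coordForm b i ⊗ₜ[ℝ] leftSMul (A.1 i j) (coordForm b j))) =
        (balancedRel (ConjDual V)).mkQ
        (∑ i, ∑ j, coordForm b i ⊗ₜ[ℝ] leftSMul (A.1 i j) (coordForm b j)) from h
    have hA : ∀ i j, star (A.1 i j) = A.1 j i := fun i j => (A.2 j i).symm
    have hs : ∀ (q : ℍ[ℝ]) (φ : ConjDual V), op (star q) • φ = leftSMul q φ := fun q φ => by
      change leftSMul (star (star q)) φ = _
      rw [star_star]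
    simp only [map_sum]
    rw [Finset.sum_comm]
    refine Finset.sum_congr rfl fun i _ => Finset.sum_congr rfl fun j _ => ?_
    rw [← hs (A.1 j i), ← hs (A.1 i j), ← hA j i, star_star, sigma]
    simp only [Submodule.mkQ_apply, Submodule.mapQ_apply, LinearEquiv.coe_coe,
      TensorProduct.comm_tmul]
    rw [Submodule.Quotient.eq]
    refine Submodule.subset_span ⟨coordForm b i, coordForm b j, star (A.1 j i), ?_⟩
    rw [star_star]⟩
  map_add' A B := by
    refine Subtype.ext ?_
    have h : ∀ (p q : ℍ[ℝ]) (φ : ConjDual V), leftSMul (p + q) φ = leftSMul p φ + leftSMul q φ :=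
      fun p q φ => LinearMap.ext fun v => add_mul _ _ _
    simp only [Submodule.coe_add, Matrix.add_apply, h, TensorProduct.tmul_add,
      Finset.sum_add_distrib, map_add]
  map_smul' r A := by
    refine Subtype.ext ?_
    have h : ∀ (q : ℍ[ℝ]) (φ : ConjDual V), leftSMul (r • q) φ = r • leftSMul q φ :=
      fun q φ => LinearMap.ext fun v => smul_mul_assoc _ _ _
    simp [h, Finset.smul_sum]

/-- The class in `Ω^{1,1}(V)` of the hyperhermitian form with the given matrix. -/
def matrixToOmega (b : Module.Basis (Fin n) ℍ[ℝ]ᵐᵒᵖ V) : HypHerm n →ₗ[ℝ] Omega V 1 :=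
  Omega.mk 1 ∘ₗ ((SymmetricAlgebra.ι ℝ (sigmaFixed (ConjDual V))).codRestrict
    (symPow (ConjDual V) 1) fun t => by
      rw [symPow, pow_one]
      exact LinearMap.mem_range_self _ t) ∘ₗ matrixForm b

/-- The class of `(Id)^m` in `Ω^{m,m}(V)`, where `Id` is the form with the identity matrix. -/
def idPow (b : Module.Basis (Fin n) ℍ[ℝ]ᵐᵒᵖ V) (m : ℕ) : Omega V m :=
  Omega.mk m ⟨SymmetricAlgebra.ι ℝ (sigmaFixed (ConjDual V)) (matrixForm b (HypHerm.id n)) ^ m,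
    Submodule.pow_mem_pow _ (LinearMap.mem_range_self _ _) m⟩

/-! ### Positivity -/

variable (V)

/-- The half line `Ω^{n,n}(V)_{≥ 0}`, where `n = dim_ℍ V`. -/
def topNonneg (n : ℕ) : Set (Omega V n) :=
  {ω | ∃ (b : Module.Basis (Fin n) ℍ[ℝ]ᵐᵒᵖ V) (t : ℝ), 0 ≤ t ∧ ω = t • idPow b n}

/-- The elements `f^* ξ` with `f : V → U`, `dim_ℍ U = k`, `ξ ∈ Ω^{k,k}(U)_{≥ 0}`. -/
def simplePositive (k : ℕ) : Set (Omega V k) :=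
  {η | ∃ (U : Type u) (_ : AddCommGroup U) (_ : Module ℍ[ℝ]ᵐᵒᵖ U)
    (_ : Module.Finite ℍ[ℝ]ᵐᵒᵖ U) (f : V →ₗ[ℍ[ℝ]ᵐᵒᵖ] U) (ξ : Omega U k),
    Module.finrank ℍ[ℝ]ᵐᵒᵖ U = k ∧ ξ ∈ topNonneg U k ∧ IsPullback f k ξ η}

/-- `C^k(V)`: the strongly positive elements of `Ω^{k,k}(V)`, i.e. the finite sums of elements
`f^* ξ` as above. -/
def strongCone (k : ℕ) : Set (Omega V k) :=
  {η | η ∈ AddSubmonoid.closure (simplePositive V k)}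

/-- `K^k(V)`: the weakly positive elements of `Ω^{k,k}(V)`, `0 ≤ k ≤ n = dim_ℍ V`. -/
def weakCone (k : ℕ) : Set (Omega V k) :=
  {η | ∀ l : ℕ, k + l = Module.finrank ℍ[ℝ]ᵐᵒᵖ V → ∀ ζ ∈ strongCone V l,
    RSpace.mul η ζ ∈ topNonneg V (k + l)}

end Matrices

end QuatForms

end

open QuatForms

/-! Everything is controlled by one real functional `f` on the symmetric algebra (`IsTopForm`). By
polarization the squares `[w ⊗ w]` span `(W ⊗ W̄)^σ`, so products of squares span `Sym^k`. The
functional kills the ideal generated by the cross terms `[x ⊗ x] [xq ⊗ y + y ⊗ xq]` and equals `1`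
on the product of the squares of a basis. It comes from `[x ⊗ x] ↦ 2 x ∧ xj` in `⋀_ℂ ℂ^{2n}`: there
`xq` lies in the complex span of `x` and `xj`, so cross terms vanish (`spinHom_cross`).

A Steinitz exchange (`exchange`) shows that, modulo cross terms, the products of squares of any two
bases are positive multiples of each other. Hence `f` is non-negative on products of `n` squares and
positive on those of bases (`prod_pos`). Every invariant hyperplane contains the cross terms,
because the reflection `w_i ↦ -w_i` negates them and fixes the product of squares. So `ker f` is the
only invariant hyperplane in degree `n` (`IsTopForm.eq_ker`), and `L^k` is the radical of the
pairing `f (x y)`.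

Strongly positive elements are then sums of non-negative multiples of products of `k` squares
(`mem_simplePositive`), and weakly positive ones are those pairing non-negatively with products of
`n - k` squares (`mem_weakCone`). So `C^k ⊆ K^k`, with equality in degrees `0` and `n`, which are
lines.

For the degrees `1` and `n - 1` the key is `IsTopForm.exists_prod_eq_evalForm`: evaluation of a
hyperhermitian form at a vector `v ≠ 0` is, up to a positive factor, the pairing with a product of
`n - 1` squares. Thus a weakly positive class of degree `1` has a non-negative matrix. Such a matrix
is a sum of matrices `x x^*` by repeated Schur complements (`HypHerm.mem_closure_rankOne`), hence
its class is strongly positive. In degree `n - 1` the trace form turns an element into a matrix.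
Weakly positive elements give non-negative matrices, and each `x x^*` comes from a strongly positive
element, so both cones have image `𝒞`. Self-duality follows from `(A, x x^*) = Re x^* A x` and the
same decomposition. -/

noncomputable section

namespace QuatForms

/-! ### Squares, polarization and generators of the symmetric powers -/

section Squares

variable {W : Type u} [AddCommGroup W] [Module ℝ W] [Module ℍ[ℝ]ᵐᵒᵖ W]

/-- The class of `x ⊗ y + y ⊗ x` in `(W ⊗_ℍ W̄)^σ`. -/
def symTensor : W →ₗ[ℝ] W →ₗ[ℝ] sigmaFixed W :=
  LinearMap.mk₂ ℝ
    (fun x y => ⟨(balancedRel W).mkQ (x ⊗ₜ[ℝ] y + y ⊗ₜ[ℝ] x), by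
      change sigma W _ = _
      simp [sigma, add_comm]⟩)
    (fun x x' y => Subtype.ext (by
      simp only [TensorProduct.add_tmul, TensorProduct.tmul_add, map_add, Submodule.coe_add]
      abel))
    (fun c x y => Subtype.ext (by
      simp only [← TensorProduct.smul_tmul', TensorProduct.tmul_smul, ← smul_add, map_smul,
        Submodule.coe_smul]))
    (fun x y y' => Subtype.ext (by
      simp only [TensorProduct.add_tmul, TensorProduct.tmul_add, map_add, Submodule.coe_add]
      abel))
    (fun c x y => Subtype.ext (by
      simp only [← TensorProduct.smul_tmul', TensorProduct.tmul_smul, ← smul_add, map_smul,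
        Submodule.coe_smul]))

/-- The class of `w ⊗ w` in `(W ⊗_ℍ W̄)^σ`. -/
def sqTensor (w : W) : sigmaFixed W :=
  ⟨(balancedRel W).mkQ (w ⊗ₜ[ℝ] w), by
    change sigma W _ = _
    simp [sigma]⟩

theorem symTensor_coe (x y : W) :
    (symTensor x y : TensorConj W) = (balancedRel W).mkQ (x ⊗ₜ[ℝ] y + y ⊗ₜ[ℝ] x) := rfl

theorem sqTensor_coe (w : W) :
    (sqTensor w : TensorConj W) = (balancedRel W).mkQ (w ⊗ₜ[ℝ] w) := rfl

theorem symTensor_comm (x y : W) : symTensor x y = symTensor y x :=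
  Subtype.ext (by rw [symTensor_coe, symTensor_coe, add_comm])

theorem symTensor_self (x : W) : symTensor x x = (2 : ℝ) • sqTensor x :=
  Subtype.ext (by rw [symTensor_coe, Submodule.coe_smul, sqTensor_coe, map_add, two_smul])

theorem sqTensor_eq (x : W) : sqTensor x = (2⁻¹ : ℝ) • symTensor x x := by
  rw [symTensor_self, smul_smul]; norm_num

theorem sqTensor_add (x y : W) :
    sqTensor (x + y) = sqTensor x + symTensor x y + sqTensor y := by
  simp only [sqTensor_eq, map_add, LinearMap.add_apply, symTensor_comm y x]
  module

theorem sqTensor_smul_real (c : ℝ) (x : W) : sqTensor (c • x) = (c ^ 2) • sqTensor x := by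
  simp only [sqTensor_eq, map_smul, LinearMap.smul_apply]
  module

theorem sqTensor_neg (x : W) : sqTensor (-x) = sqTensor x := by
  simp [sqTensor_eq]

/-- The identity `a² - b² = (a + b)(a - b)`, by which squares are compared in the exchange argument.
-/
theorem sqTensor_sub_sqTensor (x y : W) :
    sqTensor x - sqTensor y = (2⁻¹ : ℝ) • symTensor (x + y) (x - y) := by
  simp only [sqTensor_eq, map_add, map_sub, LinearMap.add_apply, symTensor_comm y x]
  module

theorem mkQ_smul_tmul (q : ℍ[ℝ]) (x y : W) :
    (balancedRel W).mkQ ((op q • x) ⊗ₜ[ℝ] y) =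
      (balancedRel W).mkQ (x ⊗ₜ[ℝ] (op (star q) • y)) := by
  rw [Submodule.mkQ_apply, Submodule.mkQ_apply, Submodule.Quotient.eq]
  exact Submodule.subset_span ⟨x, y, q, rfl⟩

/-- The balancing relation moves `q` across one summand and `q̄` across the other. -/
theorem symTensor_smul_left (q : ℍ[ℝ]) (x y : W) :
    symTensor (op q • x) y = symTensor x (op (star q) • y) := by
  refine Subtype.ext ?_
  rw [symTensor_coe, symTensor_coe, map_add, map_add, mkQ_smul_tmul]
  congr 1
  have h := mkQ_smul_tmul (star q) y x
  rw [star_star] at h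
  exact h.symm

/-- The real scalars act on `W` through the quaternions. -/
theorem op_coe_smul [IsScalarTower ℝ ℍ[ℝ]ᵐᵒᵖ W] (r : ℝ) (x : W) :
    op (r : ℍ[ℝ]) • x = r • x := by
  have h := smul_assoc r (1 : ℍ[ℝ]ᵐᵒᵖ) x
  rw [one_smul] at h
  rw [← h]
  congr 1
  apply unop_injective
  change (r : ℍ[ℝ]) = r • (1 : ℍ[ℝ])
  ext <;> simp

theorem sqTensor_smul [IsScalarTower ℝ ℍ[ℝ]ᵐᵒᵖ W] (q : ℍ[ℝ]) (x : W) :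
    sqTensor (op q • x) = Quaternion.normSq q • sqTensor x := by
  rw [sqTensor_eq, symTensor_smul_left, ← mul_smul, ← op_mul, Quaternion.self_mul_star,
    op_coe_smul, map_smul, sqTensor_eq]
  module

/-- A `σ`-fixed class is half of its symmetrization, and symmetrized pure tensors are combinations
of squares by polarization. -/
theorem span_range_sqTensor : Submodule.span ℝ (Set.range (sqTensor : W → sigmaFixed W)) = ⊤ := by
  have hsym : ∀ x y : W, symTensor x y ∈ Submodule.span ℝ (Set.range (sqTensor (W := W))) := by
    intro x y
    have h : symTensor x y = sqTensor (x + y) - sqTensor x - sqTensor y := by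
      rw [sqTensor_add]; abel
    rw [h]
    exact sub_mem (sub_mem (Submodule.subset_span ⟨_, rfl⟩) (Submodule.subset_span ⟨_, rfl⟩))
      (Submodule.subset_span ⟨_, rfl⟩)
  have key : ∀ t : W ⊗[ℝ] W, ∃ s ∈ Submodule.span ℝ (Set.range (sqTensor (W := W))),
      (s : TensorConj W) = (balancedRel W).mkQ (t + TensorProduct.comm ℝ W W t) := by
    intro t
    induction t using TensorProduct.induction_on with
    | zero => exact ⟨0, zero_mem _, by simp⟩
    | tmul x y => exact ⟨_, hsym x y, by rw [symTensor_coe, TensorProduct.comm_tmul]⟩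
    | add a b ha hb =>
      obtain ⟨s, hs, hs'⟩ := ha
      obtain ⟨s', hs₂, hs₂'⟩ := hb
      refine ⟨s + s', add_mem hs hs₂, ?_⟩
      rw [Submodule.coe_add, hs', hs₂', ← map_add]
      congr 1
      rw [map_add]
      abel
  rw [eq_top_iff]
  rintro ⟨t, ht⟩ -
  obtain ⟨t, rfl⟩ := Submodule.Quotient.mk_surjective _ t
  obtain ⟨s, hs, hs'⟩ := key t
  have ht' : sigma W (Submodule.Quotient.mk t) = Submodule.Quotient.mk t := ht
  have h : (⟨Submodule.Quotient.mk t, ht⟩ : sigmaFixed W) = (2⁻¹ : ℝ) • s := by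
    refine Subtype.ext ?_
    rw [Submodule.coe_smul, hs', map_add]
    have : (balancedRel W).mkQ (TensorProduct.comm ℝ W W t) = Submodule.Quotient.mk t := by
      conv_rhs => rw [← ht']
      simp [sigma]
    rw [this, Submodule.mkQ_apply, ← two_smul ℝ, smul_smul]
    norm_num
  rw [h]
  exact Submodule.smul_mem _ _ hs

/-- The element `[w ⊗ w]` of the symmetric algebra. -/
def sqElt (w : W) : SymAlg W := SymmetricAlgebra.ι ℝ (sigmaFixed W) (sqTensor w)

/-- The element `[x ⊗ y + y ⊗ x]` of the symmetric algebra. -/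
def symElt : W →ₗ[ℝ] W →ₗ[ℝ] SymAlg W :=
  symTensor.compr₂ (SymmetricAlgebra.ι ℝ (sigmaFixed W))

theorem symElt_apply (x y : W) :
    symElt x y = SymmetricAlgebra.ι ℝ (sigmaFixed W) (symTensor x y) := rfl

theorem symElt_comm (x y : W) : symElt x y = symElt y x := by
  rw [symElt_apply, symTensor_comm, symElt_apply]

theorem symElt_self (x : W) : symElt x x = (2 : ℝ) • sqElt x := by
  rw [symElt_apply, symTensor_self, map_smul, sqElt]

theorem sqElt_add (x y : W) : sqElt (x + y) = sqElt x + symElt x y + sqElt y := by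
  simp only [sqElt, sqTensor_add, map_add, symElt_apply]

theorem sqElt_neg (x : W) : sqElt (-x) = sqElt x := by rw [sqElt, sqTensor_neg, sqElt]

theorem sqElt_smul_real (c : ℝ) (x : W) : sqElt (c • x) = (c ^ 2) • sqElt x := by
  rw [sqElt, sqTensor_smul_real, map_smul, sqElt]

theorem sqElt_sub_sqElt (x y : W) :
    sqElt x - sqElt y = (2⁻¹ : ℝ) • symElt (x + y) (x - y) := by
  rw [sqElt, sqElt, ← map_sub, sqTensor_sub_sqTensor, map_smul, symElt_apply]

theorem sqElt_smul [IsScalarTower ℝ ℍ[ℝ]ᵐᵒᵖ W] (q : ℍ[ℝ]) (x : W) :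
    sqElt (op q • x) = Quaternion.normSq q • sqElt x := by
  rw [sqElt, sqTensor_smul, map_smul, sqElt]

theorem symPow_eq_span (k : ℕ) :
    symPow W k = Submodule.span ℝ (Set.range fun w : Fin k → W => ∏ i, sqElt (w i)) := by
  have h : LinearMap.range (SymmetricAlgebra.ι ℝ (sigmaFixed W)) =
      Submodule.span ℝ (Set.range (sqElt (W := W))) := by
    rw [LinearMap.range_eq_map, ← span_range_sqTensor, Submodule.map_span, ← Set.range_comp]
    rfl
  rw [symPow, h, Submodule.span_pow]
  congr 1
  ext x
  rw [Set.mem_pow]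
  constructor
  · rintro ⟨f, rfl⟩
    choose w hw using fun i => (f i).2
    refine ⟨w, ?_⟩
    simp only [hw, List.prod_ofFn]
  · rintro ⟨w, rfl⟩
    exact ⟨fun i => ⟨sqElt (w i), w i, rfl⟩, by simp [List.prod_ofFn]⟩

theorem prod_sqElt_mem {k : ℕ} (w : Fin k → W) : ∏ i, sqElt (w i) ∈ symPow W k := by
  rw [symPow_eq_span]
  exact Submodule.subset_span ⟨w, rfl⟩

end Squares

/-! ### Action of morphisms on squares -/

section Functoriality

variable {W₁ : Type u} [AddCommGroup W₁] [Module ℝ W₁] [Module ℍ[ℝ]ᵐᵒᵖ W₁]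
  [IsScalarTower ℝ ℍ[ℝ]ᵐᵒᵖ W₁]
  {W₂ : Type v} [AddCommGroup W₂] [Module ℝ W₂] [Module ℍ[ℝ]ᵐᵒᵖ W₂]
  [IsScalarTower ℝ ℍ[ℝ]ᵐᵒᵖ W₂]

theorem symAlgMap_sqElt (f : W₁ →ₗ[ℍ[ℝ]ᵐᵒᵖ] W₂) (w : W₁) :
    symAlgMap f (sqElt w) = sqElt (f w) := by
  rw [sqElt, symAlgMap, SymmetricAlgebra.lift_ι_apply]
  rfl

theorem symAlgMap_symElt (f : W₁ →ₗ[ℍ[ℝ]ᵐᵒᵖ] W₂) (x y : W₁) :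
    symAlgMap f (symElt x y) = symElt (f x) (f y) := by
  rw [symElt_apply, symAlgMap, SymmetricAlgebra.lift_ι_apply]
  rfl

end Functoriality

/-! ### Steinitz exchange modulo cross terms -/

section Exchange

variable {W : Type u} [AddCommGroup W] [Module ℍ[ℝ]ᵐᵒᵖ W]

/-- Since `c i` is invertible, `w i` is recovered from the new family, which therefore spans; a
spanning family of `n` vectors in dimension `n` is independent. -/
theorem linearIndependent_update {n : ℕ} [Module.Finite ℍ[ℝ]ᵐᵒᵖ W]
    (hn : Module.finrank ℍ[ℝ]ᵐᵒᵖ W = n) {w : Fin n → W}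
    (hw : LinearIndependent ℍ[ℝ]ᵐᵒᵖ w) {c : Fin n → ℍ[ℝ]ᵐᵒᵖ} {i : Fin n} (hc : c i ≠ 0) :
    LinearIndependent ℍ[ℝ]ᵐᵒᵖ (Function.update w i (∑ k, c k • w k)) := by
  have hspan := hw.span_eq_top_of_card_eq_finrank' (by simp [hn])
  refine linearIndependent_of_top_le_span_of_card_eq_finrank ?_ (by simp [hn])
  rw [← hspan, Submodule.span_le]
  set u := Function.update w i (∑ k, c k • w k) with hu
  have hne : ∀ j, j ≠ i → w j ∈ Submodule.span ℍ[ℝ]ᵐᵒᵖ (Set.range u) := fun j hj =>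
    Submodule.subset_span ⟨j, by rw [hu, Function.update_of_ne hj]⟩
  rintro _ ⟨j, rfl⟩
  by_cases hj : j = i
  · subst hj
    have h1 : w j = (c j)⁻¹ • (u j - ∑ k ∈ Finset.univ.erase j, c k • w k) := by
      rw [hu, Function.update_self, ← Finset.add_sum_erase _ _ (Finset.mem_univ j),
        add_sub_cancel_right, smul_smul, inv_mul_cancel₀ hc, one_smul]
    rw [SetLike.mem_coe, h1]
    refine Submodule.smul_mem _ _ (sub_mem (Submodule.subset_span ⟨j, rfl⟩) ?_)
    exact sum_mem fun k hk => Submodule.smul_mem _ _ (hne k (Finset.ne_of_mem_erase hk))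
  · exact hne j hj

/-- If no `e m` involved `w i`, the vectors `w k` with `k ≠ i` would span everything, including `w
i`. -/
theorem exists_coeff_ne_zero {n : ℕ} (e : Module.Basis (Fin n) ℍ[ℝ]ᵐᵒᵖ W) {w : Fin n → W}
    (hw : LinearIndependent ℍ[ℝ]ᵐᵒᵖ w) (i : Fin n) :
    ∃ (m : Fin n) (c : Fin n → ℍ[ℝ]ᵐᵒᵖ), c i ≠ 0 ∧ e m = ∑ k, c k • w k := by
  have hfin : Module.Finite ℍ[ℝ]ᵐᵒᵖ W := Module.Finite.of_basis e
  have hn : Module.finrank ℍ[ℝ]ᵐᵒᵖ W = n := by simp [Module.finrank_eq_card_basis e]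
  have hspan := hw.span_eq_top_of_card_eq_finrank' (by simp [hn])
  by_contra! hcon
  refine linearIndependent_iff_notMem_span.1 hw i ?_
  suffices h : Submodule.span ℍ[ℝ]ᵐᵒᵖ (Set.range e) ≤
      Submodule.span ℍ[ℝ]ᵐᵒᵖ (w '' (Set.univ \ {i})) by
    rw [e.span_eq] at h
    exact h trivial
  rw [Submodule.span_le]
  rintro _ ⟨m, rfl⟩
  have hm : e m ∈ Submodule.span ℍ[ℝ]ᵐᵒᵖ (Set.range w) := by rw [hspan]; trivial
  obtain ⟨c, hc⟩ := (Submodule.mem_span_range_iff_exists_fun _).1 hm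
  have hci : c i = 0 := by
    by_contra h
    exact hcon m c h hc.symm
  rw [SetLike.mem_coe, ← hc]
  refine sum_mem fun k _ => ?_
  by_cases hk : k = i
  · rw [hk, hci, zero_smul]
    exact zero_mem _
  · exact Submodule.smul_mem _ _ (Submodule.subset_span ⟨k, by simpa using hk, rfl⟩)

variable [Module ℝ W]

variable (W) in
/-- The span of the elements `[w_i ⊗ w_j q + w_j q ⊗ w_i] ∏_{k ≠ i} [w_k ⊗ w_k]` with `i ≠ j` and
`w` linearly independent. -/
def crossSpan (n : ℕ) : Submodule ℝ (SymAlg W) :=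
  Submodule.span ℝ {x | ∃ w : Fin n → W, LinearIndependent ℍ[ℝ]ᵐᵒᵖ w ∧ ∃ i j, i ≠ j ∧
    ∃ q : ℍ[ℝ]ᵐᵒᵖ, x = symElt (w i) (q • w j) * ∏ k ∈ Finset.univ.erase i, sqElt (w k)}

theorem prod_sqElt_update {n : ℕ} (w : Fin n → W) (i : Fin n) (v : W) :
    ∏ k, sqElt (Function.update w i v k) = sqElt v * ∏ k ∈ Finset.univ.erase i, sqElt (w k) := by
  rw [← Finset.mul_prod_erase _ _ (Finset.mem_univ i), Function.update_self]
  congr 1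
  exact Finset.prod_congr rfl fun k hk => by
    rw [Function.update_of_ne (Finset.ne_of_mem_erase hk)]

theorem crossSpan_le_symPow (n : ℕ) : crossSpan W n ≤ symPow W n := by
  refine Submodule.span_le.2 ?_
  rintro _ ⟨w, -, i, j, -, q, rfl⟩
  have h : symElt (w i) (q • w j) = sqElt (w i + q • w j) - sqElt (w i) - sqElt (q • w j) := by
    rw [sqElt_add]; abel
  rw [SetLike.mem_coe, h, sub_mul, sub_mul, ← prod_sqElt_update, ← prod_sqElt_update,
    ← prod_sqElt_update]
  exact sub_mem (sub_mem (prod_sqElt_mem _) (prod_sqElt_mem _)) (prod_sqElt_mem _)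

variable [IsScalarTower ℝ ℍ[ℝ]ᵐᵒᵖ W]

/-- Difference of two squares with `a = ∑ c_k w_k` and `b = c_i w_i`: here `a - b` only involves the
`w_j` with `j ≠ i`, whose squares are all present in the product. -/
theorem sqElt_sum_mul_prod {n : ℕ} (w : Fin n → W) (c : Fin n → ℍ[ℝ]ᵐᵒᵖ) (i : Fin n) :
    sqElt (∑ k, c k • w k) * ∏ k ∈ Finset.univ.erase i, sqElt (w k) -
      Quaternion.normSq (unop (c i)) • ∏ k, sqElt (w k) =
    (2⁻¹ : ℝ) • ∑ j ∈ Finset.univ.erase i, symElt (c i • w i + ∑ k, c k • w k) (c j • w j) *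
      ∏ k ∈ Finset.univ.erase i, sqElt (w k) := by
  have h1 : Quaternion.normSq (unop (c i)) • sqElt (w i) = sqElt (c i • w i) := by
    rw [← sqElt_smul, op_unop]
  rw [← Finset.mul_prod_erase _ _ (Finset.mem_univ i), ← smul_mul_assoc, h1, ← sub_mul,
    sqElt_sub_sqElt, ← Finset.sum_mul, ← map_sum, smul_mul_assoc, add_comm]
  congr 4
  rw [← Finset.add_sum_erase _ _ (Finset.mem_univ i), add_sub_cancel_left]

theorem exchange_step {n : ℕ} [Module.Finite ℍ[ℝ]ᵐᵒᵖ W]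
    (hn : Module.finrank ℍ[ℝ]ᵐᵒᵖ W = n) {w : Fin n → W}
    (hw : LinearIndependent ℍ[ℝ]ᵐᵒᵖ w) {c : Fin n → ℍ[ℝ]ᵐᵒᵖ} {i : Fin n} (hc : c i ≠ 0) :
    ∏ k, sqElt (Function.update w i (∑ k, c k • w k) k) -
      Quaternion.normSq (unop (c i)) • ∏ k, sqElt (w k) ∈ crossSpan W n := by
  rw [prod_sqElt_update, sqElt_sum_mul_prod]
  refine Submodule.smul_mem _ _ (sum_mem fun j hj => ?_)
  have hji := Finset.ne_of_mem_erase hj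
  -- The vector `c_i w_i + ∑ c_k w_k` has `i`-th coefficient `2 c_i ≠ 0`, so putting it in place of
  -- `w i` gives an independent family, as the generators of `crossSpan` require.
  let c' : Fin n → ℍ[ℝ]ᵐᵒᵖ := Function.update c i (c i + c i)
  have hc' : c' i ≠ 0 := by
    simp only [c', Function.update_self]
    intro h
    have h' : unop (c i) + unop (c i) = 0 := congrArg unop h
    rw [← two_smul ℝ, smul_eq_zero] at h'
    exact hc (unop_injective (h'.resolve_left two_ne_zero))
  have hsum : c i • w i + ∑ k, c k • w k = ∑ k, c' k • w k := by
    rw [← Finset.add_sum_erase _ _ (Finset.mem_univ i),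
      ← Finset.add_sum_erase _ (fun k => c' k • w k) (Finset.mem_univ i), ← add_assoc,
      ← add_smul]
    simp only [c', Function.update_self]
    congr 1
    exact Finset.sum_congr rfl fun k hk => by
      rw [Function.update_of_ne (Finset.ne_of_mem_erase hk)]
  rw [hsum]
  refine Submodule.subset_span ⟨_, linearIndependent_update hn hw hc', i, j, hji.symm, c j, ?_⟩
  rw [Function.update_self, Function.update_of_ne hji]
  congr 1
  exact Finset.prod_congr rfl fun k hk => by
    rw [Function.update_of_ne (Finset.ne_of_mem_erase hk)]

/-- The vectors with index in `S` have already been exchanged for members of `e`; each further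
exchange changes one new index and costs a positive factor. -/
theorem exchange_partial {n : ℕ} (e : Module.Basis (Fin n) ℍ[ℝ]ᵐᵒᵖ W) {w : Fin n → W}
    (hw : LinearIndependent ℍ[ℝ]ᵐᵒᵖ w) (S : Finset (Fin n)) :
    ∃ (r : ℝ) (w' : Fin n → W), 0 < r ∧ LinearIndependent ℍ[ℝ]ᵐᵒᵖ w' ∧
      (∀ i ∈ S, w' i ∈ Set.range e) ∧
      ∏ k, sqElt (w k) - r • ∏ k, sqElt (w' k) ∈ crossSpan W n := by
  have hfin : Module.Finite ℍ[ℝ]ᵐᵒᵖ W := Module.Finite.of_basis e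
  have hn : Module.finrank ℍ[ℝ]ᵐᵒᵖ W = n := by simp [Module.finrank_eq_card_basis e]
  induction S using Finset.induction_on with
  | empty => exact ⟨1, w, one_pos, hw, by simp, by simp⟩
  | insert i S hi ih =>
    obtain ⟨r, w', hr, hw', hS, hmem⟩ := ih
    obtain ⟨m, c, hc, hm⟩ := exists_coeff_ne_zero e hw' i
    have hpos : 0 < Quaternion.normSq (unop (c i)) :=
      lt_of_le_of_ne Quaternion.normSq_nonneg
        (Ne.symm (by simpa [Quaternion.normSq_eq_zero] using hc))
    have hstep := exchange_step hn hw' hc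
    have hli := linearIndependent_update hn hw' hc
    rw [← hm] at hstep hli
    refine ⟨r * (Quaternion.normSq (unop (c i)))⁻¹, _, by positivity, hli, ?_, ?_⟩
    · intro k hk
      by_cases hki : k = i
      · exact ⟨m, by rw [hki, Function.update_self]⟩
      · rw [Function.update_of_ne hki]
        exact hS k ((Finset.mem_insert.1 hk).resolve_left hki)
    · have h2 := sub_mem hmem (Submodule.smul_mem _
        (r * (Quaternion.normSq (unop (c i)))⁻¹) hstep)
      convert h2 using 1
      rw [smul_sub, smul_smul, mul_assoc, inv_mul_cancel₀ hpos.ne', mul_one]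
      abel

/-- Modulo `crossSpan`, all products of squares of bases are positive multiples of each other. -/
theorem exchange {n : ℕ} (e : Module.Basis (Fin n) ℍ[ℝ]ᵐᵒᵖ W) {w : Fin n → W}
    (hw : LinearIndependent ℍ[ℝ]ᵐᵒᵖ w) :
    ∃ r : ℝ, 0 < r ∧ ∏ k, sqElt (w k) - r • ∏ k, sqElt (e k) ∈ crossSpan W n := by
  obtain ⟨r, w', hr, hw', hS, hmem⟩ := exchange_partial e hw Finset.univ
  refine ⟨r, hr, ?_⟩
  -- All vectors now belong to `e`; independence forbids repetitions, so they are a permutation of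
  -- `e`.
  choose f hf using fun i => hS i (Finset.mem_univ i)
  have hinj : Function.Injective f := fun a b hab =>
    hw'.injective (by rw [← hf, ← hf, hab])
  have hbij := Finite.injective_iff_bijective.1 hinj
  have : ∏ k, sqElt (w' k) = ∏ k, sqElt (e k) := by
    simp only [← hf]
    exact Function.Bijective.prod_comp hbij fun k => sqElt (e k)
  rwa [this] at hmem

/-- Perturb a redundant `w_i` to `w_i + t v` with `v` outside the span: the span grows, so induction
on its codimension applies, and the value at `t = 0` is interpolated from `t ≠ 0`. -/
theorem prod_sqElt_mem_span {n : ℕ} [Module.Finite ℍ[ℝ]ᵐᵒᵖ W]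
    (hn : Module.finrank ℍ[ℝ]ᵐᵒᵖ W = n) (w : Fin n → W) :
    ∏ k, sqElt (w k) ∈ Submodule.span ℝ
      {x | ∃ u : Fin n → W, LinearIndependent ℍ[ℝ]ᵐᵒᵖ u ∧ x = ∏ k, sqElt (u k)} := by
  induction hd : n - Module.finrank ℍ[ℝ]ᵐᵒᵖ (Submodule.span ℍ[ℝ]ᵐᵒᵖ (Set.range w))
    using Nat.strong_induction_on generalizing w with
  | _ d ih =>
  by_cases hw : LinearIndependent ℍ[ℝ]ᵐᵒᵖ w
  · exact Submodule.subset_span ⟨w, hw, rfl⟩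
  obtain ⟨i, hi⟩ := not_forall.1 (mt linearIndependent_iff_notMem_span.2 hw)
  rw [not_not] at hi
  have hlt : Submodule.span ℍ[ℝ]ᵐᵒᵖ (Set.range w) < ⊤ := by
    refine lt_top_iff_ne_top.2 fun h => hw ?_
    exact linearIndependent_of_top_le_span_of_card_eq_finrank h.ge (by simp [hn])
  obtain ⟨v, -, hv⟩ := SetLike.exists_of_lt hlt
  have hup : ∀ t : ℝ, t ≠ 0 → ∏ k, sqElt (Function.update w i (w i + t • v) k) ∈
      Submodule.span ℝ
        {x | ∃ u : Fin n → W, LinearIndependent ℍ[ℝ]ᵐᵒᵖ u ∧ x = ∏ k, sqElt (u k)} := by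
    intro t ht
    refine ih _ ?_ _ rfl
    set u := Function.update w i (w i + t • v) with hu
    have hne : ∀ j, j ≠ i → w j ∈ Submodule.span ℍ[ℝ]ᵐᵒᵖ (Set.range u) := fun j hj =>
      Submodule.subset_span ⟨j, by rw [hu, Function.update_of_ne hj]⟩
    have hwi : w i ∈ Submodule.span ℍ[ℝ]ᵐᵒᵖ (Set.range u) := by
      refine Submodule.span_le.2 ?_ hi
      rintro _ ⟨j, hj, rfl⟩
      exact hne j (by simpa using hj)
    have hle : Submodule.span ℍ[ℝ]ᵐᵒᵖ (Set.range w) ≤ Submodule.span ℍ[ℝ]ᵐᵒᵖ (Set.range u) := by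
      refine Submodule.span_le.2 ?_
      rintro _ ⟨j, rfl⟩
      by_cases hj : j = i
      · rw [hj]; exact hwi
      · exact hne j hj
    have hvu : v ∈ Submodule.span ℍ[ℝ]ᵐᵒᵖ (Set.range u) := by
      have h1 : u i ∈ Submodule.span ℍ[ℝ]ᵐᵒᵖ (Set.range u) := Submodule.subset_span ⟨i, rfl⟩
      have h2 := sub_mem h1 hwi
      rw [hu, Function.update_self, add_sub_cancel_left, ← op_coe_smul] at h2
      have h3 := Submodule.smul_mem _ (op ((t⁻¹ : ℝ) : ℍ[ℝ])) h2
      rwa [op_coe_smul, op_coe_smul, smul_smul, inv_mul_cancel₀ ht, one_smul] at h3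
    have hlt' : Submodule.span ℍ[ℝ]ᵐᵒᵖ (Set.range w) < Submodule.span ℍ[ℝ]ᵐᵒᵖ (Set.range u) :=
      lt_of_le_of_ne hle fun h => hv (h ▸ hvu)
    have h1 := Submodule.finrank_lt_finrank_of_lt hlt'
    have h2 := Submodule.finrank_le (Submodule.span ℍ[ℝ]ᵐᵒᵖ (Set.range u))
    omega
  -- The square of `w_i + t v` is quadratic in `t`, and a quadratic polynomial satisfies `P(0) =
  -- P(1) + P(-1)/3 - P(2)/3`.
  have h1 := hup 1 one_ne_zero
  have h2 := hup (-1) (by norm_num)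
  have h3 := hup 2 two_ne_zero
  have h4 := sub_mem (add_mem h1 (Submodule.smul_mem _ (3⁻¹ : ℝ) h2))
    (Submodule.smul_mem _ (3⁻¹ : ℝ) h3)
  convert h4 using 1
  rw [prod_sqElt_update, prod_sqElt_update, prod_sqElt_update,
    ← Finset.mul_prod_erase _ _ (Finset.mem_univ i), ← smul_mul_assoc, ← smul_mul_assoc,
    ← add_mul, ← sub_mul]
  congr 1
  simp only [sqElt_add, sqElt_smul_real, map_smul]
  module

theorem symPow_eq_span_linearIndependent {n : ℕ} [Module.Finite ℍ[ℝ]ᵐᵒᵖ W]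
    (hn : Module.finrank ℍ[ℝ]ᵐᵒᵖ W = n) :
    symPow W n = Submodule.span ℝ
      {x | ∃ u : Fin n → W, LinearIndependent ℍ[ℝ]ᵐᵒᵖ u ∧ x = ∏ k, sqElt (u k)} := by
  refine le_antisymm ?_ (Submodule.span_le.2 ?_)
  · rw [symPow_eq_span, Submodule.span_le]
    rintro _ ⟨w, rfl⟩
    exact prod_sqElt_mem_span hn w
  · rintro _ ⟨u, -, rfl⟩
    exact prod_sqElt_mem u

theorem symPow_le_sup {n : ℕ} (e : Module.Basis (Fin n) ℍ[ℝ]ᵐᵒᵖ W) :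
    symPow W n ≤ Submodule.span ℝ {∏ k, sqElt (e k)} ⊔ crossSpan W n := by
  have hfin : Module.Finite ℍ[ℝ]ᵐᵒᵖ W := Module.Finite.of_basis e
  have hn : Module.finrank ℍ[ℝ]ᵐᵒᵖ W = n := by simp [Module.finrank_eq_card_basis e]
  rw [symPow_eq_span_linearIndependent hn, Submodule.span_le]
  rintro _ ⟨u, hu, rfl⟩
  obtain ⟨r, -, hr⟩ := exchange e hu
  have h := add_mem (Submodule.mem_sup_left (T := crossSpan W n)
    (Submodule.smul_mem _ r (Submodule.mem_span_singleton_self (∏ k, sqElt (e k)))))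
    (Submodule.mem_sup_right hr)
  rwa [add_sub_cancel] at h

end Exchange

/-! ### A model of the top degree inside a complex exterior algebra -/

section Exterior

/-- The algebra `⋀_ℂ ℂ^{2n}`. -/
def SpinAlg (n : ℕ) : Type := ExteriorAlgebra ℂ (Fin n × Fin 2 → ℂ)

instance (n : ℕ) : Ring (SpinAlg n) :=
  inferInstanceAs (Ring (ExteriorAlgebra ℂ (Fin n × Fin 2 → ℂ)))

instance (n : ℕ) : Algebra ℂ (SpinAlg n) :=
  inferInstanceAs (Algebra ℂ (ExteriorAlgebra ℂ (Fin n × Fin 2 → ℂ)))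

instance (n : ℕ) : Nontrivial (SpinAlg n) :=
  inferInstanceAs (Nontrivial (ExteriorAlgebra ℂ (Fin n × Fin 2 → ℂ)))

/-- The inclusion of the vectors. -/
def spinι (n : ℕ) : (Fin n × Fin 2 → ℂ) →ₗ[ℂ] SpinAlg n := ExteriorAlgebra.ι ℂ

/-- The contraction with a covector. -/
def contract {n : ℕ} (d : Module.Dual ℂ (Fin n × Fin 2 → ℂ)) : SpinAlg n →ₗ[ℂ] SpinAlg n :=
  CliffordAlgebra.contractLeft (Q := (0 : QuadraticForm ℂ (Fin n × Fin 2 → ℂ))) d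

theorem contract_one {n : ℕ} (d : Module.Dual ℂ (Fin n × Fin 2 → ℂ)) :
    contract d (1 : SpinAlg n) = 0 :=
  CliffordAlgebra.contractLeft_one (0 : QuadraticForm ℂ (Fin n × Fin 2 → ℂ)) d

theorem contract_ι_mul {n : ℕ} (d : Module.Dual ℂ (Fin n × Fin 2 → ℂ)) (a : Fin n × Fin 2 → ℂ)
    (b : SpinAlg n) : contract d (spinι n a * b) = d a • b - spinι n a * contract d b :=
  CliffordAlgebra.contractLeft_ι_mul d a b

theorem spinι_sq {n : ℕ} (a : Fin n × Fin 2 → ℂ) : spinι n a * spinι n a = 0 :=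
  ExteriorAlgebra.ι_sq_zero a

/-- The real subalgebra generated by the products of two vectors. -/
def bivectorAlg (n : ℕ) : Subalgebra ℝ (SpinAlg n) :=
  Algebra.adjoin ℝ {x | ∃ a b, x = spinι n a * spinι n b}

variable {n : ℕ}

theorem ι_mul_ι_swap (a b : Fin n × Fin 2 → ℂ) :
    spinι n a * spinι n b =
      -(spinι n b * spinι n a) :=
  eq_neg_of_add_eq_zero_left (ExteriorAlgebra.ι_add_mul_swap a b)

theorem commute_ι_mul_ι (a b c : Fin n × Fin 2 → ℂ) :
    Commute (spinι n a * spinι n b) (spinι n c) := by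
  rw [Commute, SemiconjBy, mul_assoc, ι_mul_ι_swap b c, mul_neg, ← mul_assoc, ι_mul_ι_swap a c,
    neg_mul, neg_neg, mul_assoc]

/-- Bivectors are even, hence commute; the universal property of the symmetric algebra needs a
commutative target. -/
theorem isMulCommutative_bivectorAlg : IsMulCommutative (bivectorAlg n) :=
  Algebra.isMulCommutative_adjoin ℝ (by
    rintro _ ⟨a, b, rfl⟩ _ ⟨c, d, rfl⟩
    exact (commute_ι_mul_ι a b c).mul_right (commute_ι_mul_ι a b d))

instance : CommRing (bivectorAlg n) :=
  { Subalgebra.toRing (bivectorAlg n) with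
    mul_comm := isMulCommutative_bivectorAlg.is_comm.comm }

variable {W : Type u} [AddCommGroup W] [Module ℝ W] [Module ℍ[ℝ]ᵐᵒᵖ W]
  [IsScalarTower ℝ ℍ[ℝ]ᵐᵒᵖ W]

/-- The complex number `z` in `q = z + j z'`. -/
def firstCoord (q : ℍ[ℝ]) : ℂ := ⟨q.re, q.imI⟩

/-- The complex number `z'` in `q = z + j z'`. -/
def secondCoord (q : ℍ[ℝ]) : ℂ := ⟨q.imJ, -q.imK⟩

theorem repr_real_smul (e : Module.Basis (Fin n) ℍ[ℝ]ᵐᵒᵖ W) (r : ℝ) (w : W) (i : Fin n) :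
    unop (e.repr (r • w) i) = r • unop (e.repr w i) := by
  rw [← op_coe_smul, map_smul, Finsupp.smul_apply, smul_eq_mul, unop_mul, unop_op,
    Quaternion.mul_coe_eq_smul]

/-- The complex coordinates of a vector. -/
def spinor (e : Module.Basis (Fin n) ℍ[ℝ]ᵐᵒᵖ W) : W →ₗ[ℝ] (Fin n × Fin 2 → ℂ) where
  toFun w p := if p.2 = 0 then firstCoord (unop (e.repr w p.1))
    else secondCoord (unop (e.repr w p.1))
  map_add' x y := by
    ext p
    by_cases hp : p.2 = 0 <;> apply Complex.ext <;>
      simp [hp, firstCoord, secondCoord]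
    ring
  map_smul' r x := by
    ext p
    by_cases hp : p.2 = 0 <;> apply Complex.ext <;>
      simp only [hp, firstCoord, secondCoord, repr_real_smul] <;> simp [hp]

/-- The complex coordinates of `w · j`. -/
def spinorJ (e : Module.Basis (Fin n) ℍ[ℝ]ᵐᵒᵖ W) : W →ₗ[ℝ] (Fin n × Fin 2 → ℂ) where
  toFun w p := if p.2 = 0 then -star (secondCoord (unop (e.repr w p.1)))
    else star (firstCoord (unop (e.repr w p.1)))
  map_add' x y := by
    ext p
    by_cases hp : p.2 = 0 <;> apply Complex.ext <;>
      simp [hp, firstCoord, secondCoord] <;> ring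
  map_smul' r x := by
    ext p
    by_cases hp : p.2 = 0 <;> apply Complex.ext <;>
      simp only [hp, firstCoord, secondCoord, repr_real_smul] <;> simp [hp]

theorem spinor_smul (e : Module.Basis (Fin n) ℍ[ℝ]ᵐᵒᵖ W) (q : ℍ[ℝ]ᵐᵒᵖ) (w : W) :
    spinor e (q • w) = firstCoord (unop q) • spinor e w + secondCoord (unop q) • spinorJ e w := by
  ext p
  by_cases hp : p.2 = 0 <;> apply Complex.ext <;>
    simp [spinor, spinorJ, hp, firstCoord, secondCoord] <;> ring

theorem spinorJ_smul (e : Module.Basis (Fin n) ℍ[ℝ]ᵐᵒᵖ W) (q : ℍ[ℝ]ᵐᵒᵖ) (w : W) :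
    spinorJ e (q • w) =
      -star (secondCoord (unop q)) • spinor e w + star (firstCoord (unop q)) • spinorJ e w := by
  ext p
  by_cases hp : p.2 = 0 <;> apply Complex.ext <;>
    simp [spinor, spinorJ, hp, firstCoord, secondCoord] <;> ring

/-- The bivector `x ∧ y j + y ∧ x j`. -/
def bivector (e : Module.Basis (Fin n) ℍ[ℝ]ᵐᵒᵖ W) : W →ₗ[ℝ] W →ₗ[ℝ] SpinAlg n :=
  LinearMap.mk₂ ℝ
    (fun x y => spinι n (spinor e x) * spinι n (spinorJ e y) +
      spinι n (spinor e y) * spinι n (spinorJ e x))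
    (fun x x' y => by simp only [map_add, add_mul, mul_add]; abel)
    (fun c x y => by
      simp only [map_smul, LinearMap.map_smul_of_tower, smul_mul_assoc, mul_smul_comm, smul_add])
    (fun x y y' => by simp only [map_add, add_mul, mul_add]; abel)
    (fun c x y => by
      simp only [map_smul, LinearMap.map_smul_of_tower, smul_mul_assoc, mul_smul_comm, smul_add])

theorem bivector_apply (e : Module.Basis (Fin n) ℍ[ℝ]ᵐᵒᵖ W) (x y : W) :
    bivector e x y = spinι n (spinor e x) * spinι n (spinorJ e y) +
      spinι n (spinor e y) * spinι n (spinorJ e x) := rfl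

theorem bivector_comm (e : Module.Basis (Fin n) ℍ[ℝ]ᵐᵒᵖ W) (x y : W) :
    bivector e x y = bivector e y x := by
  rw [bivector_apply, bivector_apply, add_comm]

/-- After expansion the two sides differ only in the order of `x ∧ y` and `xj ∧ yj`, where
antisymmetry matches the signs. -/
theorem bivector_balanced (e : Module.Basis (Fin n) ℍ[ℝ]ᵐᵒᵖ W) (q : ℍ[ℝ]) (x y : W) :
    bivector e (op q • x) y = bivector e x (op (star q) • y) := by
  have h1 : firstCoord (star q) = star (firstCoord q) := by
    apply Complex.ext <;> simp [firstCoord]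
  have h2 : secondCoord (star q) = -secondCoord q := by
    apply Complex.ext <;> simp [secondCoord]
  simp only [bivector_apply, spinor_smul, spinorJ_smul, unop_op, h1, h2, star_neg, star_star,
    neg_neg, map_add, map_smul, add_mul, mul_add, smul_mul_assoc, mul_smul_comm]
  rw [ι_mul_ι_swap (spinor e y) (spinor e x), ι_mul_ι_swap (spinorJ e x) (spinorJ e y)]
  module

/-- The map `W ⊗_ℍ W̄ → ⋀²` induced by `bivector`. -/
def tensorBivector (e : Module.Basis (Fin n) ℍ[ℝ]ᵐᵒᵖ W) : TensorConj W →ₗ[ℝ] SpinAlg n :=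
  (balancedRel W).liftQ (TensorProduct.lift (bivector e)) (by
    refine Submodule.span_le.2 ?_
    rintro _ ⟨x, y, q, rfl⟩
    simp [bivector_balanced])

theorem tensorBivector_mkQ (e : Module.Basis (Fin n) ℍ[ℝ]ᵐᵒᵖ W) (x y : W) :
    tensorBivector e ((balancedRel W).mkQ (x ⊗ₜ[ℝ] y)) = bivector e x y := rfl

theorem bivector_mem (e : Module.Basis (Fin n) ℍ[ℝ]ᵐᵒᵖ W) (x y : W) :
    bivector e x y ∈ bivectorAlg n :=
  add_mem (Algebra.subset_adjoin ⟨_, _, rfl⟩) (Algebra.subset_adjoin ⟨_, _, rfl⟩)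

theorem tensorBivector_mem (e : Module.Basis (Fin n) ℍ[ℝ]ᵐᵒᵖ W) (t : TensorConj W) :
    tensorBivector e t ∈ bivectorAlg n := by
  obtain ⟨t, rfl⟩ := Submodule.mkQ_surjective _ t
  induction t using TensorProduct.induction_on with
  | zero => rw [map_zero, map_zero]; exact zero_mem _
  | tmul x y => rw [tensorBivector_mkQ]; exact bivector_mem e x y
  | add a b ha hb => rw [map_add, map_add]; exact add_mem ha hb

/-- The induced homomorphism on the symmetric algebra. -/
def spinHom (e : Module.Basis (Fin n) ℍ[ℝ]ᵐᵒᵖ W) : SymAlg W →ₐ[ℝ] SpinAlg n :=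
  (bivectorAlg n).val.comp (SymmetricAlgebra.lift
    (LinearMap.codRestrict (Subalgebra.toSubmodule (bivectorAlg n))
      (tensorBivector e ∘ₗ (sigmaFixed W).subtype) fun t => tensorBivector_mem e t))

theorem spinHom_sqElt (e : Module.Basis (Fin n) ℍ[ℝ]ᵐᵒᵖ W) (x : W) :
    spinHom e (sqElt x) = (2 : ℂ) •
      (spinι n (spinor e x) * spinι n (spinorJ e x)) := by
  have h : spinHom e (sqElt x) = tensorBivector e ((balancedRel W).mkQ (x ⊗ₜ[ℝ] x)) := by
    rw [spinHom, sqElt, AlgHom.comp_apply, SymmetricAlgebra.lift_ι_apply]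
    rfl
  rw [h, tensorBivector_mkQ, bivector_apply, two_smul]

theorem spinHom_symElt (e : Module.Basis (Fin n) ℍ[ℝ]ᵐᵒᵖ W) (x y : W) :
    spinHom e (symElt x y) = (2 : ℂ) • bivector e x y := by
  have h : spinHom e (symElt x y) =
      tensorBivector e ((balancedRel W).mkQ (x ⊗ₜ[ℝ] y + y ⊗ₜ[ℝ] x)) := by
    rw [spinHom, symElt_apply, AlgHom.comp_apply, SymmetricAlgebra.lift_ι_apply]
    rfl
  rw [h, map_add, map_add, tensorBivector_mkQ, tensorBivector_mkQ, bivector_comm e y x, two_smul]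

/-- Both `xq` and `xqj` lie in the complex plane of `x` and `xj`, which `x ∧ xj` annihilates. -/
theorem spinHom_cross (e : Module.Basis (Fin n) ℍ[ℝ]ᵐᵒᵖ W) (x y : W) (q : ℍ[ℝ]ᵐᵒᵖ) :
    spinHom e (sqElt x * symElt (q • x) y) = 0 := by
  have h1 : spinι n (spinor e x) * spinι n (spinorJ e x) *
      spinι n (spinorJ e x) = 0 := by
    rw [mul_assoc, spinι_sq, mul_zero]
  have h2 : spinι n (spinor e x) * spinι n (spinorJ e x) *
      spinι n (spinor e x) = 0 := by
    rw [(commute_ι_mul_ι _ _ _).eq, ← mul_assoc, spinι_sq, zero_mul]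
  rw [map_mul, spinHom_sqElt, spinHom_symElt, bivector_apply,
    ι_mul_ι_swap (spinor e y) (spinorJ e (q • x)), spinor_smul, spinorJ_smul]
  simp only [map_add, map_smul, add_mul, mul_add, smul_mul_assoc, mul_smul_comm, mul_neg,
    ← mul_assoc, h1, h2, zero_mul, smul_zero, add_zero, neg_zero]

theorem spinor_basis (e : Module.Basis (Fin n) ℍ[ℝ]ᵐᵒᵖ W) (i : Fin n) :
    spinor e (e i) = Pi.single (i, 0) 1 := by
  ext ⟨k, a⟩
  rcases eq_or_ne k i with rfl | hk
  · fin_cases a <;> apply Complex.ext <;> simp [spinor, firstCoord, secondCoord]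
  · fin_cases a <;> apply Complex.ext <;>
      simp [spinor, firstCoord, secondCoord, hk]

theorem spinorJ_basis (e : Module.Basis (Fin n) ℍ[ℝ]ᵐᵒᵖ W) (i : Fin n) :
    spinorJ e (e i) = Pi.single (i, 1) 1 := by
  ext ⟨k, a⟩
  rcases eq_or_ne k i with rfl | hk
  · fin_cases a <;> apply Complex.ext <;> simp [spinorJ, firstCoord, secondCoord]
  · fin_cases a <;> apply Complex.ext <;>
      simp [spinorJ, firstCoord, secondCoord, hk]

theorem contract_spinHom_prod (e : Module.Basis (Fin n) ℍ[ℝ]ᵐᵒᵖ W) (S : Finset (Fin n))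
    (d : Module.Dual ℂ (Fin n × Fin 2 → ℂ))
    (hd : ∀ i ∈ S, d (spinor e (e i)) = 0 ∧ d (spinorJ e (e i)) = 0) :
    contract d (spinHom e (∏ i ∈ S, sqElt (e i))) = 0 := by
  induction S using Finset.induction_on with
  | empty => simp [contract_one]
  | insert i S hi ih =>
    have hdi := hd i (Finset.mem_insert_self i S)
    have ih' := ih fun j hj => hd j (Finset.mem_insert_of_mem hj)
    rw [Finset.prod_insert hi, map_mul, spinHom_sqElt, smul_mul_assoc, map_smul, mul_assoc]
    rw [contract_ι_mul, contract_ι_mul, hdi.1, hdi.2, ih']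
    simp

/-- Contraction with the two coordinate covectors of index `i` strips the factor `e_i ∧ e_i j` off
the product, so vanishing would descend to the empty product `1`. -/
theorem spinHom_prod_ne_zero (e : Module.Basis (Fin n) ℍ[ℝ]ᵐᵒᵖ W) (S : Finset (Fin n)) :
    spinHom e (∏ i ∈ S, sqElt (e i)) ≠ 0 := by
  induction S using Finset.induction_on with
  | empty => simp
  | insert i S hi ih =>
    intro h
    apply ih
    have hd : ∀ a : Fin 2, contract
        (LinearMap.proj (i, a) : Module.Dual ℂ (Fin n × Fin 2 → ℂ))
        (spinHom e (∏ i ∈ S, sqElt (e i))) = 0 := by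
      intro a
      refine contract_spinHom_prod e S _ fun j hj => ?_
      have hij : i ≠ j := fun hij => hi (hij ▸ hj)
      rw [spinor_basis, spinorJ_basis]
      simp [hij]
    rw [Finset.prod_insert hi, map_mul, spinHom_sqElt, smul_mul_assoc, mul_assoc] at h
    have h := (smul_eq_zero.1 h).resolve_left two_ne_zero
    have h0 := congrArg (contract
      (LinearMap.proj (i, 0) : Module.Dual ℂ (Fin n × Fin 2 → ℂ))) h
    have h1 := congrArg (contract
      (LinearMap.proj (i, 1) : Module.Dual ℂ (Fin n × Fin 2 → ℂ))) h0
    rw [contract_ι_mul, contract_ι_mul, hd 0,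
      spinor_basis, spinorJ_basis] at h1
    simp at h1
    rw [contract_ι_mul, hd 1] at h1
    simpa using h1

/-- A linear functional on the symmetric algebra that vanishes on the ideal generated by the
elements `[x ⊗ x] [x q ⊗ y + y ⊗ x q]` but not on the product of the squares of a basis. -/
theorem exists_topForm (e : Module.Basis (Fin n) ℍ[ℝ]ᵐᵒᵖ W) :
    ∃ f : SymAlg W →ₗ[ℝ] ℝ,
      (∀ (x y : W) (q : ℍ[ℝ]ᵐᵒᵖ) (z : SymAlg W), f (sqElt x * symElt (q • x) y * z) = 0) ∧ f (∏ i, sqElt (e i)) = 1 := by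
  have hne := spinHom_prod_ne_zero e Finset.univ
  obtain ⟨g, hg⟩ := not_forall.1 (mt (Module.forall_dual_apply_eq_zero_iff ℝ _).1 hne)
  refine ⟨(g (spinHom e (∏ i, sqElt (e i))))⁻¹ • (g ∘ₗ (spinHom e).toLinearMap), ?_, ?_⟩
  · intro x y q z
    simp only [LinearMap.smul_apply, LinearMap.comp_apply, AlgHom.toLinearMap_apply]
    rw [map_mul, spinHom_cross, zero_mul, map_zero, smul_zero]
  · simp only [LinearMap.smul_apply, LinearMap.comp_apply, AlgHom.toLinearMap_apply, smul_eq_mul]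
    exact inv_mul_cancel₀ hg

end Exterior

/-! ### The Moore map -/

section TopForm

variable {W : Type u} [AddCommGroup W] [Module ℝ W] [Module ℍ[ℝ]ᵐᵒᵖ W]

/-- A linear functional on the symmetric algebra that vanishes on the ideal generated by the
elements `[x ⊗ x] [x q ⊗ y + y ⊗ x q]` and takes the value `1` at `∏ [e_i ⊗ e_i]`. -/
structure IsTopForm {n : ℕ} (e : Module.Basis (Fin n) ℍ[ℝ]ᵐᵒᵖ W) (f : SymAlg W →ₗ[ℝ] ℝ) :
    Prop where
  cross : ∀ (x y : W) (q : ℍ[ℝ]ᵐᵒᵖ) (z : SymAlg W), f (sqElt x * symElt (q • x) y * z) = 0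
  prod_basis : f (∏ i, sqElt (e i)) = 1

namespace IsTopForm

variable {n : ℕ} {e : Module.Basis (Fin n) ℍ[ℝ]ᵐᵒᵖ W} {f : SymAlg W →ₗ[ℝ] ℝ}

theorem cross_prod (hf : IsTopForm e f) {ι : Type*} (S : Finset ι)
    (w : ι → W) (x : W) (q : ℍ[ℝ]ᵐᵒᵖ) {j : ι} (hj : j ∈ S) (y : SymAlg W) :
    f (symElt x (q • w j) * (∏ k ∈ S, sqElt (w k)) * y) = 0 := by
  classical
  rw [← Finset.mul_prod_erase _ _ hj, symElt_comm]
  convert hf.cross (w j) x q ((∏ k ∈ S.erase j, sqElt (w k)) * y) using 2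
  ring

/-- Some `w i` is a combination of the others. In `2 [w_i ⊗ w_i] = [w_i ⊗ w_i + w_i ⊗ w_i]` expand
one slot accordingly: every term is a cross term. -/
theorem prod_eq_zero (hf : IsTopForm e f) {ι : Type*} [Fintype ι] {w : ι → W}
    (hw : ¬LinearIndependent ℍ[ℝ]ᵐᵒᵖ w) (y : SymAlg W) : f ((∏ i, sqElt (w i)) * y) = 0 := by
  classical
  obtain ⟨i, hi⟩ := not_forall.1 (mt linearIndependent_iff_notMem_span.2 hw)
  rw [not_not] at hi
  have h : ∀ v ∈ Submodule.span ℍ[ℝ]ᵐᵒᵖ (w '' (Set.univ \ {i})), ∀ q : ℍ[ℝ]ᵐᵒᵖ,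
      f (symElt (w i) (q • v) * (∏ k ∈ Finset.univ.erase i, sqElt (w k)) * y) = 0 := by
    intro v hv
    induction hv using Submodule.span_induction with
    | zero => simp
    | add x y _ _ hx hy =>
      intro q
      simp only [smul_add, map_add, add_mul, hx, hy, add_zero]
    | smul a x _ hx =>
      intro q
      rw [← mul_smul]
      exact hx _
    | mem x hx =>
      intro q
      obtain ⟨j, hj, rfl⟩ := hx
      exact hf.cross_prod _ _ _ _ (by simpa using hj) _
  have h' := h _ hi 1
  rw [one_smul, symElt_self, smul_mul_assoc, smul_mul_assoc, Finset.mul_prod_erase _ (fun k => sqElt (w k))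
    (Finset.mem_univ i), map_smul] at h'
  exact (smul_eq_zero.1 h').resolve_left two_ne_zero

theorem crossSpan_eq_zero (hf : IsTopForm e f) {x : SymAlg W} (hx : x ∈ crossSpan W n) :
    f x = 0 := by
  suffices h : crossSpan W n ≤ LinearMap.ker f from h hx
  refine Submodule.span_le.2 ?_
  rintro _ ⟨w, -, i, j, hij, q, rfl⟩
  have h := hf.cross_prod (Finset.univ.erase i) w (w i) q
    (Finset.mem_erase.2 ⟨hij.symm, Finset.mem_univ j⟩) 1
  rwa [mul_one] at h

variable [IsScalarTower ℝ ℍ[ℝ]ᵐᵒᵖ W]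

/-- The pullback of an element of `crossSpan` lies in the radical of the top form. -/
theorem map_crossSpan_eq_zero (hf : IsTopForm e f)
    {W' : Type v} [AddCommGroup W'] [Module ℝ W'] [Module ℍ[ℝ]ᵐᵒᵖ W']
    [IsScalarTower ℝ ℍ[ℝ]ᵐᵒᵖ W'] (g : W' →ₗ[ℍ[ℝ]ᵐᵒᵖ] W) {k : ℕ} {x : SymAlg W'}
    (hx : x ∈ crossSpan W' k) (y : SymAlg W) : f (symAlgMap g x * y) = 0 := by
  suffices h : crossSpan W' k ≤ LinearMap.ker
      (f ∘ₗ LinearMap.mulRight ℝ y ∘ₗ (symAlgMap g).toLinearMap) from h hx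
  refine Submodule.span_le.2 ?_
  rintro _ ⟨w, -, i, j, hij, q, rfl⟩
  change f (symAlgMap g _ * y) = 0
  rw [map_mul (symAlgMap g), symAlgMap_symElt, map_prod, map_smul]
  simp only [symAlgMap_sqElt]
  exact hf.cross_prod (Finset.univ.erase i) (fun k => g (w k)) (g (w i)) q
    (Finset.mem_erase.2 ⟨hij.symm, Finset.mem_univ j⟩) y

theorem prod_pos (hf : IsTopForm e f) {w : Fin n → W} (hw : LinearIndependent ℍ[ℝ]ᵐᵒᵖ w) :
    0 < f (∏ i, sqElt (w i)) := by
  obtain ⟨r, hr, hmem⟩ := exchange e hw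
  have h := hf.crossSpan_eq_zero hmem
  rw [map_sub, map_smul, hf.prod_basis, sub_eq_zero, smul_eq_mul, mul_one] at h
  rwa [h]

theorem prod_nonneg (hf : IsTopForm e f) (w : Fin n → W) : 0 ≤ f (∏ i, sqElt (w i)) := by
  by_cases hw : LinearIndependent ℍ[ℝ]ᵐᵒᵖ w
  · exact (hf.prod_pos hw).le
  · have h := hf.prod_eq_zero hw 1
    rw [mul_one] at h
    exact h.ge

/-- Degree `n` is the line of `∏ [e_i ⊗ e_i]` plus `crossSpan`, and `f` reads off the coefficient on
the line. Hence `crossSpan` is exactly the kernel of `f` in degree `n`. -/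
theorem sub_mem_crossSpan (hf : IsTopForm e f) {x : SymAlg W} (hx : x ∈ symPow W n) :
    x - f x • ∏ i, sqElt (e i) ∈ crossSpan W n := by
  obtain ⟨a, ha, c, hc, rfl⟩ := Submodule.mem_sup.1 (symPow_le_sup e hx)
  obtain ⟨t, rfl⟩ := Submodule.mem_span_singleton.1 ha
  rw [map_add, map_smul, hf.prod_basis, hf.crossSpan_eq_zero hc, smul_eq_mul, mul_one, add_zero,
    add_sub_cancel_left]
  exact hc

theorem mem_crossSpan_iff (hf : IsTopForm e f) {x : SymAlg W} (hx : x ∈ symPow W n) :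
    x ∈ crossSpan W n ↔ f x = 0 := by
  refine ⟨hf.crossSpan_eq_zero, fun h => ?_⟩
  have h' := hf.sub_mem_crossSpan hx
  rwa [h, zero_smul, sub_zero] at h'

theorem isInvariantHyperplane_ker (hf : IsTopForm e f) :
    IsInvariantHyperplane W n (LinearMap.ker (f ∘ₗ (symPow W n).subtype)) := by
  constructor
  · intro g x hx
    have hx' : (x : SymAlg W) ∈ crossSpan W n := (hf.mem_crossSpan_iff x.2).2 hx
    have h := hf.map_crossSpan_eq_zero g.toLinearMap hx' 1
    rw [mul_one] at h
    exact h
  · have hsurj : Function.Surjective (f ∘ₗ (symPow W n).subtype) := fun r =>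
      ⟨r • ⟨_, prod_sqElt_mem e⟩, by
        rw [map_smul, LinearMap.comp_apply, Submodule.subtype_apply, hf.prod_basis,
          smul_eq_mul, mul_one]⟩
    rw [(LinearMap.quotKerEquivOfSurjective _ hsurj).finrank_eq, Module.finrank_self]

end IsTopForm

end TopForm

/-! ### Uniqueness of the invariant hyperplane and description of the kernels -/

section Uniqueness

variable {W : Type u} [AddCommGroup W] [Module ℍ[ℝ]ᵐᵒᵖ W] {n : ℕ}

theorem exists_linearEquiv_map_eq [Module.Finite ℍ[ℝ]ᵐᵒᵖ W]
    (hn : Module.finrank ℍ[ℝ]ᵐᵒᵖ W = n) {w u : Fin n → W}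
    (hw : LinearIndependent ℍ[ℝ]ᵐᵒᵖ w) (hu : LinearIndependent ℍ[ℝ]ᵐᵒᵖ u) :
    ∃ g : W ≃ₗ[ℍ[ℝ]ᵐᵒᵖ] W, ∀ i, g (w i) = u i := by
  have hw' := hw.span_eq_top_of_card_eq_finrank' (by simp [hn])
  have hu' := hu.span_eq_top_of_card_eq_finrank' (by simp [hn])
  refine ⟨(Module.Basis.mk hw hw'.ge).equiv (Module.Basis.mk hu hu'.ge) (Equiv.refl _),
    fun i => ?_⟩
  have h := (Module.Basis.mk hw hw'.ge).equiv_apply i (Module.Basis.mk hu hu'.ge) (Equiv.refl _)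
  simpa using h

variable [Module ℝ W] [IsScalarTower ℝ ℍ[ℝ]ᵐᵒᵖ W]

theorem symPowMap_mk_prod (g : W →ₗ[ℍ[ℝ]ᵐᵒᵖ] W) (w : Fin n → W) :
    symPowMap g n ⟨∏ i, sqElt (w i), prod_sqElt_mem w⟩ =
      ⟨∏ i, sqElt (g (w i)), prod_sqElt_mem fun i => g (w i)⟩ := by
  refine Subtype.ext ?_
  change symAlgMap g (∏ i, sqElt (w i)) = _
  simp only [map_prod, symAlgMap_sqElt]

namespace IsInvariantHyperplane

variable {N : Submodule ℝ (symPow W n)}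

theorem ne_top (hN : IsInvariantHyperplane W n N) : N ≠ ⊤ := by
  rintro rfl
  have h := hN.2
  rw [Module.finrank_zero_of_subsingleton] at h
  exact zero_ne_one h

/-- Automorphisms permute bases transitively, so one such product in `N` would force all of them
into `N`, and they span. -/
theorem prod_notMem [Module.Finite ℍ[ℝ]ᵐᵒᵖ W] (hn : Module.finrank ℍ[ℝ]ᵐᵒᵖ W = n)
    (hN : IsInvariantHyperplane W n N) {w : Fin n → W} (hw : LinearIndependent ℍ[ℝ]ᵐᵒᵖ w) :
    (⟨∏ i, sqElt (w i), prod_sqElt_mem w⟩ : symPow W n) ∉ N := by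
  intro h
  refine hN.ne_top (eq_top_iff.2 ?_)
  have hle : symPow W n ≤ N.map (symPow W n).subtype := by
    conv_lhs => rw [symPow_eq_span_linearIndependent hn]
    refine Submodule.span_le.2 ?_
    rintro _ ⟨u, hu, rfl⟩
    obtain ⟨g, hg⟩ := exists_linearEquiv_map_eq hn hw hu
    refine ⟨_, hN.1 g _ h, ?_⟩
    rw [symPowMap_mk_prod]
    change ∏ i, sqElt (g (w i)) = _
    simp only [hg]
  rintro x -
  obtain ⟨y, hy, hxy⟩ := hle x.2
  rwa [← Subtype.ext hxy]

/-- The reflection `w_i ↦ -w_i` negates the cross term `x` and fixes the product `p` of squares. As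
`p` spans the quotient by `N`, some `a p - x` lies in `N`; comparison with its reflection `a p + x`
puts `x` in `N`. -/
theorem crossSpan_le [Module.Finite ℍ[ℝ]ᵐᵒᵖ W] (hn : Module.finrank ℍ[ℝ]ᵐᵒᵖ W = n)
    (hN : IsInvariantHyperplane W n N) : crossSpan W n ≤ N.map (symPow W n).subtype := by
  refine Submodule.span_le.2 ?_
  rintro x ⟨w, hw, i, j, hij, q, hx⟩
  have hxs : x ∈ symPow W n :=
    crossSpan_le_symPow n (Submodule.subset_span ⟨w, hw, i, j, hij, q, hx⟩)
  -- The reflected family is obtained from `linearIndependent_update` with the single coefficient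
  -- `-1` at `i`.
  have hsum : ∑ k, (Pi.single i (-1) : Fin n → ℍ[ℝ]ᵐᵒᵖ) k • w k = -w i := by
    rw [Finset.sum_eq_single i (fun k _ hk => by simp [hk]) (by simp)]
    simp
  have hu := linearIndependent_update hn hw (c := Pi.single i (-1)) (i := i) (by simp)
  rw [hsum] at hu
  obtain ⟨g, hg⟩ := exists_linearEquiv_map_eq hn hw hu
  have hgne : ∀ k, k ≠ i → g (w k) = w k := fun k hk => by rw [hg, Function.update_of_ne hk]
  have hgi : g (w i) = -w i := by rw [hg, Function.update_self]
  have hgx : symAlgMap g.toLinearMap x = -x := by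
    rw [hx, map_mul, symAlgMap_symElt, map_prod, map_smul]
    simp only [symAlgMap_sqElt, LinearEquiv.coe_coe, hgi, hgne j hij.symm, map_neg,
      LinearMap.neg_apply, neg_mul]
    congr 2
    exact Finset.prod_congr rfl fun k hk => by rw [hgne k (Finset.ne_of_mem_erase hk)]
  have hgp : symPowMap g.toLinearMap n ⟨∏ i, sqElt (w i), prod_sqElt_mem w⟩ =
      ⟨∏ i, sqElt (w i), prod_sqElt_mem w⟩ := by
    rw [symPowMap_mk_prod]
    refine Subtype.ext ?_
    change ∏ i, sqElt (g (w i)) = ∏ i, sqElt (w i)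
    refine Finset.prod_congr rfl fun k _ => ?_
    by_cases hk : k = i
    · rw [hk, hgi, sqElt_neg]
    · rw [hgne k hk]
  set p : symPow W n := ⟨∏ i, sqElt (w i), prod_sqElt_mem w⟩ with hp
  have hpN : p ∉ N := prod_notMem hn hN hw
  have hp0 : N.mkQ p ≠ 0 := by simpa using hpN
  obtain ⟨a, ha⟩ := (finrank_eq_one_iff_of_nonzero' _ hp0).1 hN.2 (N.mkQ ⟨x, hxs⟩)
  rw [← map_smul, ← sub_eq_zero, ← map_sub] at ha
  have ha : a • p - ⟨x, hxs⟩ ∈ N :=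
    (Submodule.Quotient.mk_eq_zero N).1 ha
  have hga := hN.1 g _ ha
  rw [map_sub, map_smul, hgp] at hga
  have hgx' : symPowMap g.toLinearMap n ⟨x, hxs⟩ = -⟨x, hxs⟩ := Subtype.ext hgx
  rw [hgx', sub_neg_eq_add] at hga
  refine ⟨⟨x, hxs⟩, ?_, rfl⟩
  have h := Submodule.smul_mem N (2⁻¹ : ℝ) (sub_mem hga ha)
  have h2 : (2⁻¹ : ℝ) • (a • p + ⟨x, hxs⟩ - (a • p - ⟨x, hxs⟩)) = ⟨x, hxs⟩ := by module
  rwa [h2] at h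

end IsInvariantHyperplane

theorem IsTopForm.eq_ker {e : Module.Basis (Fin n) ℍ[ℝ]ᵐᵒᵖ W} {f : SymAlg W →ₗ[ℝ] ℝ}
    (hf : IsTopForm e f) {N : Submodule ℝ (symPow W n)} (hN : IsInvariantHyperplane W n N) :
    N = LinearMap.ker (f ∘ₗ (symPow W n).subtype) := by
  have hfin : Module.Finite ℍ[ℝ]ᵐᵒᵖ W := Module.Finite.of_basis e
  have hn : Module.finrank ℍ[ℝ]ᵐᵒᵖ W = n := by simp [Module.finrank_eq_card_basis e]
  have hle : LinearMap.ker (f ∘ₗ (symPow W n).subtype) ≤ N := by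
    intro x hx
    obtain ⟨y, hy, hxy⟩ := IsInvariantHyperplane.crossSpan_le hn hN ((hf.mem_crossSpan_iff x.2).2 hx)
    rwa [← Subtype.ext hxy]
  refine le_antisymm (fun x hx => ?_) hle
  by_contra hxf
  have hxf : f x ≠ 0 := hxf
  refine hN.ne_top (eq_top_iff.2 fun y _ => ?_)
  have h : y - (f y / f x) • x ∈ N := hle (by
    change f (y - (f y / f x) • x) = 0
    rw [map_sub, map_smul, smul_eq_mul, div_mul_cancel₀ _ hxf, sub_self])
  have h' := add_mem h (Submodule.smul_mem N (f y / f x) hx)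
  rwa [sub_add_cancel] at h'

theorem IsTopForm.mem_mooreKernel {e : Module.Basis (Fin n) ℍ[ℝ]ᵐᵒᵖ W} {f : SymAlg W →ₗ[ℝ] ℝ}
    (hf : IsTopForm e f) (x : symPow W n) : x ∈ mooreKernel W n ↔ f x = 0 := by
  have h : mooreKernel W n = LinearMap.ker (f ∘ₗ (symPow W n).subtype) := by
    refine le_antisymm (sInf_le hf.isInvariantHyperplane_ker) (le_sInf fun N hN => ?_)
    exact (hf.eq_ker hN).ge
  rw [h]
  rfl

/-- From here on the Moore map is replaced by `f`. -/
theorem IsTopForm.mem_leftKernel {e : Module.Basis (Fin n) ℍ[ℝ]ᵐᵒᵖ W} {f : SymAlg W →ₗ[ℝ] ℝ}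
    (hf : IsTopForm e f) {k l : ℕ} (hkl : k + l = n) (x : symPow W k) :
    x ∈ leftKernel W k ↔ ∀ y : symPow W l, f (x * y) = 0 := by
  subst hkl
  have hn : Module.finrank ℍ[ℝ]ᵐᵒᵖ W = k + l := by simp [Module.finrank_eq_card_basis e]
  constructor
  · intro h y
    exact (hf.mem_mooreKernel _).1 (h l hn.symm y)
  · intro h l' hl' y
    obtain rfl : l' = l := by omega
    exact (hf.mem_mooreKernel _).2 (h y)

end Uniqueness

/-! ### Hyperhermitian matrices -/

namespace HypHerm

variable {n : ℕ}

/-- The sesquilinear form `∑ x̄_i a_{ij} y_j`. -/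
def form (A : HypHerm n) (x y : Fin n → ℍ[ℝ]) : ℍ[ℝ] := ∑ i, ∑ j, star (x i) * A.1 i j * y j

theorem star_apply (A : HypHerm n) (i j : Fin n) : star (A.1 i j) = A.1 j i := (A.2 j i).symm

theorem star_form (A : HypHerm n) (x y : Fin n → ℍ[ℝ]) : star (form A x y) = form A y x := by
  simp only [form, star_sum, star_mul, star_star, star_apply]
  rw [Finset.sum_comm]
  simp only [mul_assoc]

theorem form_add_left (A : HypHerm n) (x x' y : Fin n → ℍ[ℝ]) :
    form A (x + x') y = form A x y + form A x' y := by
  simp only [form, Pi.add_apply, star_add, add_mul, Finset.sum_add_distrib]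

theorem form_add_right (A : HypHerm n) (x y y' : Fin n → ℍ[ℝ]) :
    form A x (y + y') = form A x y + form A x y' := by
  simp only [form, Pi.add_apply, mul_add, Finset.sum_add_distrib]

theorem form_single_left (A : HypHerm n) (p : Fin n) (s : ℍ[ℝ]) (y : Fin n → ℍ[ℝ]) :
    form A (Pi.single p s) y = star s * ∑ j, A.1 p j * y j := by
  rw [form, Finset.sum_eq_single p (fun i _ hi => by simp [hi]) (by simp), Finset.mul_sum]
  simp only [Pi.single_eq_same, mul_assoc]

theorem form_self (A : HypHerm n) (x : Fin n → ℍ[ℝ]) :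
    form A x x = ((form A x x).re : ℍ[ℝ]) :=
  (Quaternion.star_eq_self).1 (star_form A x x)

theorem apply_self (A : HypHerm n) (p : Fin n) : A.1 p p = ((A.1 p p).re : ℍ[ℝ]) :=
  (Quaternion.star_eq_self).1 (star_apply A p p)

theorem mem_nonnegCone {A : HypHerm n} : A ∈ nonnegCone n ↔ ∀ x, 0 ≤ (form A x x).re := by
  refine forall_congr' fun x => ⟨?_, fun h => ⟨_, h, form_self A x⟩⟩
  rintro ⟨r, hr, h⟩
  change 0 ≤ (∑ i, ∑ j, star (x i) * A.1 i j * x j).re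
  rwa [h, Quaternion.re_coe]

theorem form_add_matrix (A B : HypHerm n) (x y : Fin n → ℍ[ℝ]) :
    form (A + B) x y = form A x y + form B x y := by
  simp only [form, Submodule.coe_add, Matrix.add_apply, mul_add, add_mul, Finset.sum_add_distrib]

theorem form_sub_matrix (A B : HypHerm n) (x y : Fin n → ℍ[ℝ]) :
    form (A - B) x y = form A x y - form B x y := by
  simp only [form, Submodule.coe_sub, Matrix.sub_apply, mul_sub, sub_mul, Finset.sum_sub_distrib]

theorem form_smul_matrix (c : ℝ) (A : HypHerm n) (x y : Fin n → ℍ[ℝ]) :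
    form (c • A) x y = c • form A x y := by
  simp only [form, Submodule.coe_smul, Matrix.smul_apply, mul_smul_comm, smul_mul_assoc,
    Finset.smul_sum]

theorem re_form_add_single (A : HypHerm n) (p : Fin n) (s : ℍ[ℝ]) (x : Fin n → ℍ[ℝ]) :
    (form A (x + Pi.single p s) (x + Pi.single p s)).re = (form A x x).re +
      2 * (star s * ∑ j, A.1 p j * x j).re + (A.1 p p).re * Quaternion.normSq s := by
  have h1 : form A x (Pi.single p s) = star (star s * ∑ j, A.1 p j * x j) := by
    rw [← form_single_left, star_form]
  have h2 : form A (Pi.single p s) (Pi.single p s) =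
      (((A.1 p p).re * Quaternion.normSq s : ℝ) : ℍ[ℝ]) := by
    rw [form_single_left, Finset.sum_eq_single p (fun i _ hi => by simp [hi]) (by simp),
      Pi.single_eq_same, apply_self A p, Quaternion.re_coe, Quaternion.coe_mul,
      ← Quaternion.star_mul_self, ← mul_assoc, ← mul_assoc, Quaternion.coe_commutes]
  rw [form_add_left, form_add_right, form_add_right, h1, h2, form_single_left]
  simp only [Quaternion.re_add, Quaternion.re_coe, Quaternion.re_star]
  ring

/-- The matrix `x x^*`. -/
def rankOne (x : Fin n → ℍ[ℝ]) : HypHerm n :=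
  ⟨Matrix.of fun i j => x i * star (x j), fun i j => by simp⟩

theorem rankOne_apply (x : Fin n → ℍ[ℝ]) (i j : Fin n) :
    (rankOne x).1 i j = x i * star (x j) := rfl

theorem form_rankOne (x y : Fin n → ℍ[ℝ]) :
    form (rankOne x) y y = ((Quaternion.normSq (∑ i, star (x i) * y i) : ℝ) : ℍ[ℝ]) := by
  rw [← Quaternion.star_mul_self, star_sum, Finset.sum_mul_sum]
  simp only [form, rankOne_apply, star_mul, star_star, mul_assoc]

theorem rankOne_real_smul (c : ℝ) (x : Fin n → ℍ[ℝ]) : rankOne (c • x) = c ^ 2 • rankOne x := by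
  refine Subtype.ext (Matrix.ext fun i j => ?_)
  rw [Submodule.coe_smul, Matrix.smul_apply, rankOne_apply, rankOne_apply]
  simp only [Pi.smul_apply, Quaternion.star_smul, smul_mul_assoc, mul_smul_comm, smul_smul]
  rw [pow_two]

theorem rankOne_mem (x : Fin n → ℍ[ℝ]) : rankOne x ∈ nonnegCone n := by
  rw [mem_nonnegCone]
  intro y
  rw [form_rankOne, Quaternion.re_coe]
  exact Quaternion.normSq_nonneg

theorem add_mem_nonnegCone {A B : HypHerm n} (hA : A ∈ nonnegCone n) (hB : B ∈ nonnegCone n) :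
    A + B ∈ nonnegCone n := by
  rw [mem_nonnegCone] at *
  intro x
  rw [form_add_matrix, Quaternion.re_add]
  exact add_nonneg (hA x) (hB x)

theorem smul_mem_nonnegCone {A : HypHerm n} {c : ℝ} (hc : 0 ≤ c) (hA : A ∈ nonnegCone n) :
    c • A ∈ nonnegCone n := by
  rw [mem_nonnegCone] at *
  intro x
  rw [form_smul_matrix, Quaternion.re_smul, smul_eq_mul]
  exact mul_nonneg hc (hA x)

theorem zero_mem_nonnegCone : (0 : HypHerm n) ∈ nonnegCone n := by
  have h := smul_mem_nonnegCone le_rfl (rankOne_mem (n := n) 0)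
  rwa [zero_smul] at h

theorem re_star_mul_self (q : ℍ[ℝ]) : (star q * q).re = Quaternion.normSq q := by
  rw [Quaternion.star_mul_self, Quaternion.re_coe]

theorem row_eq_zero {A : HypHerm n} (hA : A ∈ nonnegCone n) {p : Fin n} (hp : (A.1 p p).re = 0)
    (j : Fin n) : A.1 p j = 0 := by
  rw [mem_nonnegCone] at hA
  have key : ∀ x : Fin n → ℍ[ℝ], ∑ j, A.1 p j * x j = 0 := by
    intro x
    by_contra hne
    set L := ∑ j, A.1 p j * x j with hL
    have hpos : 0 < Quaternion.normSq L :=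
      lt_of_le_of_ne Quaternion.normSq_nonneg (Ne.symm (Quaternion.normSq_ne_zero.2 hne))
    -- With `a_pp = 0` the form is affine in the added multiple of `L`; this multiple makes its
    -- value `-(x^* A x) - 2|L|² < 0`.
    have h := hA (x + Pi.single p (-((form A x x).re / Quaternion.normSq L + 1) • L))
    rw [re_form_add_single, hp, zero_mul, add_zero, ← hL, Quaternion.star_smul, smul_mul_assoc,
      Quaternion.re_smul, re_star_mul_self, smul_eq_mul, neg_mul, add_mul,
      div_mul_cancel₀ _ hpos.ne'] at h
    have := hA x
    linarith
  have h := key (Pi.single j 1)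
  rwa [Finset.sum_eq_single j (fun i _ hi => by simp [hi]) (by simp), Pi.single_eq_same,
    mul_one] at h

/-- The Schur complement of a positive diagonal entry is non-negative. -/
theorem schur_mem {A : HypHerm n} (hA : A ∈ nonnegCone n) {p : Fin n} (hp : 0 < (A.1 p p).re) :
    A - (A.1 p p).re⁻¹ • rankOne (fun i => A.1 i p) ∈ nonnegCone n := by
  rw [mem_nonnegCone] at *
  intro x
  set r := (A.1 p p).re with hr
  set L := ∑ j, A.1 p j * x j with hL
  -- Completing the square: this shift minimizes the form in the direction `p`, and the minimum is
  -- the Schur complement at `x`.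
  have h := hA (x + Pi.single p (-r⁻¹ • L))
  rw [re_form_add_single, ← hL, ← hr, Quaternion.star_smul, smul_mul_assoc, Quaternion.re_smul,
    re_star_mul_self, smul_eq_mul, Quaternion.normSq_smul] at h
  rw [form_sub_matrix, form_smul_matrix, form_rankOne, Quaternion.re_sub,
    Quaternion.re_smul, Quaternion.re_coe, smul_eq_mul]
  simp only [star_apply, ← hL]
  convert h using 1
  field_simp
  ring

/-- Gaussian elimination on the nonzero rows: a zero diagonal entry kills its row, and a positive
one is removed by subtracting a multiple of a rank-one matrix that leaves a non-negative matrix. -/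
theorem mem_closure_rankOne_of_support (S : Finset (Fin n)) (A : HypHerm n)
    (hA : A ∈ nonnegCone n) (hS : ∀ i, i ∉ S → ∀ j, A.1 i j = 0) :
    A ∈ AddSubmonoid.closure (Set.range (rankOne (n := n))) := by
  induction S using Finset.induction_on generalizing A with
  | empty =>
    have h : A = 0 := Subtype.ext (Matrix.ext fun i j => hS i (Finset.notMem_empty i) j)
    rw [h]
    exact zero_mem _
  | insert p S hpS ih =>
    have hnn : 0 ≤ (A.1 p p).re := by
      have h := mem_nonnegCone.1 hA (Pi.single p 1)
      rwa [form_single_left, Finset.sum_eq_single p (fun i _ hi => by simp [hi]) (by simp),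
        Pi.single_eq_same, star_one, one_mul, mul_one] at h
    rcases hnn.eq_or_lt with h0 | hpos
    · refine ih A hA fun i hi j => ?_
      by_cases hip : i = p
      · rw [hip]
        exact row_eq_zero hA h0.symm j
      · exact hS i (by simp [hip, hi]) j
    · have h1 := ih _ (schur_mem hA hpos) fun i hi j => by
        rw [Submodule.coe_sub, Submodule.coe_smul, Matrix.sub_apply, Matrix.smul_apply,
          rankOne_apply, star_apply]
        by_cases hip : i = p
        · subst hip
          have hmul : A.1 i i * A.1 i j = (A.1 i i).re • A.1 i j := by
            conv_lhs => rw [apply_self A i, Quaternion.coe_mul_eq_smul]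
          rw [hmul, smul_smul, inv_mul_cancel₀ hpos.ne', one_smul, sub_self]
        · rw [hS i (by simp [hip, hi]) j, hS i (by simp [hip, hi]) p]
          simp
      -- The closure is only additive, so the positive scalar is absorbed into the vector by a
      -- square root.
      have h2 : (A.1 p p).re⁻¹ • rankOne (fun i => A.1 i p) =
          rankOne (√((A.1 p p).re⁻¹) • fun i => A.1 i p) := by
        rw [rankOne_real_smul, Real.sq_sqrt (by positivity)]
      rw [← sub_add_cancel A ((A.1 p p).re⁻¹ • rankOne (fun i => A.1 i p))]
      refine add_mem h1 ?_
      rw [h2]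
      exact AddSubmonoid.subset_closure ⟨_, rfl⟩

/-- A non-negative definite matrix is a sum of matrices `x x^*`. -/
theorem mem_closure_rankOne {A : HypHerm n} (hA : A ∈ nonnegCone n) :
    A ∈ AddSubmonoid.closure (Set.range (rankOne (n := n))) :=
  mem_closure_rankOne_of_support Finset.univ A hA fun i hi => absurd (Finset.mem_univ i) hi

/-- The trace form as a bilinear form. -/
def traceBilin (n : ℕ) : LinearMap.BilinForm ℝ (HypHerm n) :=
  LinearMap.mk₂ ℝ traceForm
    (fun A B C => by
      simp only [traceForm, Submodule.coe_add, add_mul, Matrix.add_apply, Finset.sum_add_distrib,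
        Quaternion.re_add])
    (fun c A B => by
      simp only [traceForm, Submodule.coe_smul, smul_mul_assoc, Matrix.smul_apply,
        ← Finset.smul_sum, Quaternion.re_smul])
    (fun A B C => by
      simp only [traceForm, Submodule.coe_add, mul_add, Matrix.add_apply, Finset.sum_add_distrib,
        Quaternion.re_add])
    (fun c A B => by
      simp only [traceForm, Submodule.coe_smul, mul_smul_comm, Matrix.smul_apply,
        ← Finset.smul_sum, Quaternion.re_smul])

theorem traceBilin_apply (A B : HypHerm n) : traceBilin n A B = traceForm A B := rfl

theorem re_sum {ι : Type*} (s : Finset ι) (f : ι → ℍ[ℝ]) : (∑ i ∈ s, f i).re = ∑ i ∈ s, (f i).re :=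
  map_sum (⟨⟨QuaternionAlgebra.re, Quaternion.re_zero⟩, Quaternion.re_add⟩ : ℍ[ℝ] →+ ℝ) f s

theorem re_mul_comm (p q : ℍ[ℝ]) : (p * q).re = (q * p).re := by
  simp only [Quaternion.re_mul]
  ring

theorem traceForm_eq (A B : HypHerm n) : traceForm A B = ∑ i, ∑ j, (A.1 i j * B.1 j i).re := by
  simp only [traceForm, Matrix.mul_apply, re_sum]

theorem traceForm_comm (A B : HypHerm n) : traceForm A B = traceForm B A := by
  rw [traceForm_eq, traceForm_eq, Finset.sum_comm]
  simp only [re_mul_comm (A.1 _ _)]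

theorem traceForm_rankOne (A : HypHerm n) (x : Fin n → ℍ[ℝ]) :
    traceForm A (rankOne x) = (form A x x).re := by
  rw [traceForm_eq, form, re_sum]
  refine Finset.sum_congr rfl fun i _ => ?_
  rw [re_sum]
  refine Finset.sum_congr rfl fun j _ => ?_
  rw [rankOne_apply, ← mul_assoc, re_mul_comm, mul_assoc]

/-- Decompose `B` into matrices `x x^*`; against each of them the trace form is the value of `A` at
`x`. -/
theorem traceForm_nonneg {A B : HypHerm n} (hA : A ∈ nonnegCone n) (hB : B ∈ nonnegCone n) :
    0 ≤ traceForm A B := by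
  have hB' := mem_closure_rankOne hB
  clear hB
  induction hB' using AddSubmonoid.closure_induction with
  | mem x hx =>
    obtain ⟨x, rfl⟩ := hx
    rw [traceForm_rankOne]
    exact mem_nonnegCone.1 hA x
  | zero => rw [← traceBilin_apply, map_zero]
  | add x y _ _ hx hy =>
    rw [← traceBilin_apply, map_add]
    exact add_nonneg hx hy

theorem mem_nonnegCone_iff_traceForm {A : HypHerm n} :
    A ∈ nonnegCone n ↔ ∀ B ∈ nonnegCone n, 0 ≤ traceForm A B := by
  refine ⟨fun hA B hB => traceForm_nonneg hA hB, fun h => mem_nonnegCone.2 fun x => ?_⟩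
  rw [← traceForm_rankOne]
  exact h _ (rankOne_mem x)

theorem eq_zero_of_traceForm_self {A : HypHerm n} (h : traceForm A A ≤ 0) : A = 0 := by
  have hterm : ∀ i j, (A.1 i j * A.1 j i).re = Quaternion.normSq (A.1 i j) := fun i j => by
    rw [← star_apply A i j, Quaternion.self_mul_star, Quaternion.re_coe]
  simp only [traceForm_eq, hterm] at h
  refine Subtype.ext (Matrix.ext fun i j => Quaternion.normSq_eq_zero.1 ?_)
  have h0 := le_antisymm h (Finset.sum_nonneg fun i _ => Finset.sum_nonneg fun j _ =>
    Quaternion.normSq_nonneg)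
  have h1 := (Finset.sum_eq_zero_iff_of_nonneg fun i _ => Finset.sum_nonneg fun j _ =>
    Quaternion.normSq_nonneg).1 h0 i (Finset.mem_univ i)
  exact (Finset.sum_eq_zero_iff_of_nonneg fun j _ => Quaternion.normSq_nonneg).1 h1 j
    (Finset.mem_univ j)

/-- Both `A` and `-A` are non-negative, so `(A, -A) ≥ 0`, whereas `(A, A) = ∑ |a_ij|²`. -/
theorem eq_zero_of_form {A : HypHerm n} (h : ∀ x, (form A x x).re = 0) : A = 0 := by
  have h1 : A ∈ nonnegCone n := mem_nonnegCone.2 fun x => (h x).ge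
  have h2 : -A ∈ nonnegCone n := mem_nonnegCone.2 fun x => by
    rw [← neg_one_smul ℝ A, form_smul_matrix, Quaternion.re_smul, h x, smul_zero]
  have h3 := traceForm_nonneg h1 h2
  rw [← traceBilin_apply, map_neg, traceBilin_apply] at h3
  exact eq_zero_of_traceForm_self (by linarith)

theorem traceBilin_nondegenerate (n : ℕ) : (traceBilin n).Nondegenerate := by
  constructor
  · intro A hA
    exact eq_zero_of_traceForm_self (hA A).le
  · intro A hA
    exact eq_zero_of_traceForm_self (hA A).le

end HypHerm

/-! ### The conjugate dual -/

section Dual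

variable {V : Type u} [AddCommGroup V] [Module ℍ[ℝ]ᵐᵒᵖ V]

/-- The value `φ(v)`. -/
def ConjDual.eval (φ : ConjDual V) (v : V) : ℍ[ℝ] := (show V →ₗ[ℍ[ℝ]ᵐᵒᵖ] ℍ[ℝ] from φ) v

theorem ConjDual.ext {φ ψ : ConjDual V} (h : ∀ v, φ.eval v = ψ.eval v) : φ = ψ := LinearMap.ext h

theorem ConjDual.eval_add (φ ψ : ConjDual V) (v : V) : (φ + ψ).eval v = φ.eval v + ψ.eval v := rfl

theorem ConjDual.eval_real_smul (r : ℝ) (φ : ConjDual V) (v : V) :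
    (r • φ).eval v = r • φ.eval v := rfl

theorem ConjDual.eval_smul (q : ℍ[ℝ]ᵐᵒᵖ) (φ : ConjDual V) (v : V) :
    (q • φ).eval v = star (unop q) * φ.eval v := rfl

theorem ConjDual.eval_leftSMul (q : ℍ[ℝ]) (φ : ConjDual V) (v : V) :
    (leftSMul q φ).eval v = q * φ.eval v := rfl

theorem ConjDual.eval_sum {ι : Type*} (s : Finset ι) (φ : ι → ConjDual V) (v : V) :
    (∑ i ∈ s, φ i).eval v = ∑ i ∈ s, (φ i).eval v :=
  map_sum (⟨⟨fun φ : ConjDual V => φ.eval v, rfl⟩, fun _ _ => rfl⟩ : ConjDual V →+ ℍ[ℝ]) φ s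

theorem ConjDual.eval_vec_smul (φ : ConjDual V) (q : ℍ[ℝ]ᵐᵒᵖ) (v : V) :
    φ.eval (q • v) = φ.eval v * unop q :=
  map_smul (show V →ₗ[ℍ[ℝ]ᵐᵒᵖ] ℍ[ℝ] from φ) q v

theorem ConjDual.eval_vec_sum (φ : ConjDual V) {ι : Type*} (s : Finset ι) (v : ι → V) :
    φ.eval (∑ i ∈ s, v i) = ∑ i ∈ s, φ.eval (v i) :=
  map_sum (show V →ₗ[ℍ[ℝ]ᵐᵒᵖ] ℍ[ℝ] from φ) v s

variable {n : ℕ}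

theorem coordForm_eval (b : Module.Basis (Fin n) ℍ[ℝ]ᵐᵒᵖ V) (i : Fin n) (v : V) :
    (coordForm b i).eval v = unop (b.repr v i) := rfl

theorem coordForm_eval_basis (b : Module.Basis (Fin n) ℍ[ℝ]ᵐᵒᵖ V) (i j : Fin n) :
    (coordForm b i).eval (b j) = if i = j then 1 else 0 := by
  rw [coordForm_eval, b.repr_self, Finsupp.single_apply]
  by_cases h : i = j
  · simp [h]
  · simp [h, Ne.symm h]

theorem eval_sum_smul_coordForm (b : Module.Basis (Fin n) ℍ[ℝ]ᵐᵒᵖ V) (c : Fin n → ℍ[ℝ]ᵐᵒᵖ)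
    (j : Fin n) : (∑ i, c i • coordForm b i).eval (b j) = star (unop (c j)) := by
  rw [ConjDual.eval_sum, Finset.sum_eq_single j]
  · rw [ConjDual.eval_smul, coordForm_eval_basis, if_pos rfl, mul_one]
  · intro i _ hi
    rw [ConjDual.eval_smul, coordForm_eval_basis, if_neg hi, mul_zero]
  · exact fun h => absurd (Finset.mem_univ j) h

/-- The conjugation compensates for the right action `φ · q = q̄ φ`. -/
theorem eq_sum_coordForm (b : Module.Basis (Fin n) ℍ[ℝ]ᵐᵒᵖ V) (φ : ConjDual V) :
    φ = ∑ i, op (star (φ.eval (b i))) • coordForm b i := by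
  refine ConjDual.ext fun v => ?_
  conv_lhs => rw [← b.sum_repr v]
  rw [ConjDual.eval_vec_sum, ConjDual.eval_sum]
  refine Finset.sum_congr rfl fun i _ => ?_
  rw [ConjDual.eval_vec_smul, ConjDual.eval_smul, coordForm_eval, unop_op, star_star]

/-- The coordinates form a basis of the conjugate dual. -/
def coordBasis (b : Module.Basis (Fin n) ℍ[ℝ]ᵐᵒᵖ V) :
    Module.Basis (Fin n) ℍ[ℝ]ᵐᵒᵖ (ConjDual V) :=
  Module.Basis.mk (v := coordForm b)
    (by
      rw [Fintype.linearIndependent_iff]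
      intro c hc j
      have h := eval_sum_smul_coordForm b c j
      rw [hc] at h
      exact unop_injective (star_eq_zero.1 h.symm))
    (by
      rintro φ -
      rw [eq_sum_coordForm b φ]
      exact sum_mem fun i _ => Submodule.smul_mem _ _ (Submodule.subset_span ⟨i, rfl⟩))

theorem coordBasis_apply (b : Module.Basis (Fin n) ℍ[ℝ]ᵐᵒᵖ V) (i : Fin n) :
    coordBasis b i = coordForm b i := by
  rw [coordBasis, Module.Basis.mk_apply]

/-- The value of a hyperhermitian form at a vector. -/
def evalForm (v : V) : TensorConj (ConjDual V) →ₗ[ℝ] ℝ :=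
  (balancedRel (ConjDual V)).liftQ
    (TensorProduct.lift (LinearMap.mk₂ ℝ (fun φ ψ : ConjDual V => (star (φ.eval v) * ψ.eval v).re)
      (fun φ φ' ψ => by
        rw [ConjDual.eval_add, star_add, add_mul, Quaternion.re_add])
      (fun c φ ψ => by
        rw [ConjDual.eval_real_smul, Quaternion.star_smul, smul_mul_assoc, Quaternion.re_smul])
      (fun φ ψ ψ' => by
        rw [ConjDual.eval_add, mul_add, Quaternion.re_add])
      (fun c φ ψ => by
        rw [ConjDual.eval_real_smul, mul_smul_comm, Quaternion.re_smul])))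
    (by
      refine Submodule.span_le.2 ?_
      rintro _ ⟨φ, ψ, q, rfl⟩
      simp only [SetLike.mem_coe, LinearMap.mem_ker, map_sub, TensorProduct.lift.tmul,
        LinearMap.mk₂_apply, ConjDual.eval_smul, unop_op, star_star, star_mul, mul_assoc, sub_self])

theorem evalForm_mkQ (v : V) (φ ψ : ConjDual V) :
    evalForm v ((balancedRel (ConjDual V)).mkQ (φ ⊗ₜ[ℝ] ψ)) = (star (φ.eval v) * ψ.eval v).re :=
  rfl

theorem evalForm_sqTensor (v : V) (φ : ConjDual V) :
    evalForm v (sqTensor φ) = Quaternion.normSq (φ.eval v) := by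
  rw [sqTensor_coe, evalForm_mkQ, Quaternion.star_mul_self, Quaternion.re_coe]

theorem matrixForm_coe (b : Module.Basis (Fin n) ℍ[ℝ]ᵐᵒᵖ V) (A : HypHerm n) :
    (matrixForm b A : TensorConj (ConjDual V)) = (balancedRel (ConjDual V)).mkQ
      (∑ i, ∑ j, coordForm b i ⊗ₜ[ℝ] leftSMul (A.1 i j) (coordForm b j)) := rfl

theorem evalForm_matrixForm (b : Module.Basis (Fin n) ℍ[ℝ]ᵐᵒᵖ V) (A : HypHerm n) (v : V) :
    evalForm v (matrixForm b A) =
      (HypHerm.form A (fun i => (coordForm b i).eval v) fun i => (coordForm b i).eval v).re := by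
  simp only [matrixForm_coe, map_sum, evalForm_mkQ, ConjDual.eval_leftSMul, HypHerm.form,
    HypHerm.re_sum, mul_assoc]

theorem matrixForm_rankOne (b : Module.Basis (Fin n) ℍ[ℝ]ᵐᵒᵖ V) (q : Fin n → ℍ[ℝ]) :
    matrixForm b (HypHerm.rankOne q) = sqTensor (∑ i, op (q i) • coordForm b i) := by
  refine Subtype.ext ?_
  rw [matrixForm_coe, sqTensor_coe, TensorProduct.sum_tmul, map_sum, map_sum]
  refine Finset.sum_congr rfl fun i _ => ?_
  rw [TensorProduct.tmul_sum, map_sum, map_sum]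
  refine Finset.sum_congr rfl fun j _ => ?_
  rw [mkQ_smul_tmul, ← mul_smul, ← op_mul, HypHerm.rankOne_apply]
  congr 2
  refine ConjDual.ext fun v => ?_
  rw [ConjDual.eval_leftSMul, ConjDual.eval_smul, unop_op, star_mul, star_star]

theorem sqTensor_eq_matrixForm (b : Module.Basis (Fin n) ℍ[ℝ]ᵐᵒᵖ V) (φ : ConjDual V) :
    sqTensor φ = matrixForm b (HypHerm.rankOne fun i => star (φ.eval (b i))) := by
  rw [matrixForm_rankOne, ← eq_sum_coordForm]

theorem matrixForm_surjective (b : Module.Basis (Fin n) ℍ[ℝ]ᵐᵒᵖ V) :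
    Function.Surjective (matrixForm b) := by
  rw [← LinearMap.range_eq_top, eq_top_iff, ← span_range_sqTensor, Submodule.span_le]
  rintro _ ⟨φ, rfl⟩
  exact ⟨_, (sqTensor_eq_matrixForm b φ).symm⟩

theorem HypHerm.id_eq_sum (n : ℕ) :
    HypHerm.id n = ∑ i, HypHerm.rankOne (Pi.single i 1 : Fin n → ℍ[ℝ]) := by
  refine Subtype.ext (Matrix.ext fun i j => ?_)
  rw [Submodule.coe_sum, Matrix.sum_apply, Finset.sum_eq_single i]
  · rw [HypHerm.rankOne_apply, Pi.single_eq_same, one_mul]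
    change (1 : Matrix (Fin n) (Fin n) ℍ[ℝ]) i j = _
    rcases eq_or_ne i j with rfl | h
    · simp
    · simp [h, Ne.symm h]
  · intro k _ hk
    rw [HypHerm.rankOne_apply, Pi.single_eq_of_ne (Ne.symm hk), zero_mul]
  · exact fun h => absurd (Finset.mem_univ i) h

theorem ι_matrixForm_id (b : Module.Basis (Fin n) ℍ[ℝ]ᵐᵒᵖ V) :
    SymmetricAlgebra.ι ℝ (sigmaFixed (ConjDual V)) (matrixForm b (HypHerm.id n)) =
      ∑ i, sqElt (coordForm b i) := by
  rw [HypHerm.id_eq_sum, map_sum, map_sum]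
  refine Finset.sum_congr rfl fun i _ => ?_
  rw [matrixForm_rankOne, Finset.sum_eq_single i, Pi.single_eq_same, op_one, one_smul, sqElt]
  · intro k _ hk
    rw [Pi.single_eq_of_ne hk, op_zero, zero_smul]
  · exact fun h => absurd (Finset.mem_univ i) h

end Dual

/-! ### The top degree and the pairing -/

section Pairing

variable {V : Type u} [AddCommGroup V] [Module ℍ[ℝ]ᵐᵒᵖ V] {n : ℕ}
  {e : Module.Basis (Fin n) ℍ[ℝ]ᵐᵒᵖ (ConjDual V)} {f : SymAlg (ConjDual V) →ₗ[ℝ] ℝ}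

/-- The complementary degree is `0`, where only real scalars occur. -/
theorem IsTopForm.mem_leftKernel_top (hf : IsTopForm e f) (x : symPow (ConjDual V) n) :
    x ∈ leftKernel (ConjDual V) n ↔ f x = 0 := by
  rw [hf.mem_leftKernel (add_zero n)]
  constructor
  · intro h
    have h1 := h ⟨1, by rw [symPow, pow_zero]; exact Submodule.mem_one.2 ⟨1, map_one _⟩⟩
    rwa [mul_one] at h1
  · rintro h ⟨y, hy⟩
    rw [symPow, pow_zero] at hy
    obtain ⟨r, rfl⟩ := Submodule.mem_one.1 hy
    change f (x * algebraMap ℝ _ r) = 0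
    rw [mul_comm, ← Algebra.smul_def, map_smul, h, smul_zero]

/-- The functional on the top degree induced by a top form. -/
def IsTopForm.topVal (hf : IsTopForm e f) : Omega V n →ₗ[ℝ] ℝ :=
  (leftKernel (ConjDual V) n).liftQ (f ∘ₗ (symPow (ConjDual V) n).subtype)
    fun x hx => (hf.mem_leftKernel_top x).1 hx

theorem IsTopForm.topVal_mk (hf : IsTopForm e f) (x : symPow (ConjDual V) n) :
    hf.topVal (Omega.mk n x) = f x := rfl

theorem IsTopForm.topVal_injective (hf : IsTopForm e f) : Function.Injective hf.topVal := by
  rw [injective_iff_map_eq_zero]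
  intro ω h
  obtain ⟨x, rfl⟩ := Submodule.mkQ_surjective _ ω
  exact (Submodule.Quotient.mk_eq_zero _).2 ((hf.mem_leftKernel_top x).2 h)

theorem Omega.mk_surjective (k : ℕ) : Function.Surjective (Omega.mk (V := V) k) :=
  Submodule.mkQ_surjective _

/-- The class of `∏ [φ_i ⊗ φ_i]`. -/
def sqProd {k : ℕ} (w : Fin k → ConjDual V) : Omega V k :=
  Omega.mk k ⟨∏ i, sqElt (w i), prod_sqElt_mem w⟩

section Complementary

variable {k l : ℕ} {e : Module.Basis (Fin (k + l)) ℍ[ℝ]ᵐᵒᵖ (ConjDual V)} (hf : IsTopForm e f)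

/-- The product followed by the functional on the top degree, as a map on the first factor. -/
def IsTopForm.pairingFun (ζ : Omega V l) : Omega V k →ₗ[ℝ] ℝ where
  toFun η := hf.topVal (RSpace.mul η ζ)
  map_add' η η' := by
    obtain ⟨x, rfl⟩ := Omega.mk_surjective _ η
    obtain ⟨x', rfl⟩ := Omega.mk_surjective _ η'
    obtain ⟨y, rfl⟩ := Omega.mk_surjective _ ζ
    change f ((x + x' : SymAlg (ConjDual V)) * y) = f (x * y) + f (x' * y)
    rw [add_mul, map_add]
  map_smul' c η := by
    obtain ⟨x, rfl⟩ := Omega.mk_surjective _ η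
    obtain ⟨y, rfl⟩ := Omega.mk_surjective _ ζ
    change f ((c • x : SymAlg (ConjDual V)) * y) = c • f (x * y)
    rw [smul_mul_assoc, map_smul]

/-- The pairing of complementary degrees. -/
def IsTopForm.pairing : Omega V l →ₗ[ℝ] Omega V k →ₗ[ℝ] ℝ where
  toFun ζ := hf.pairingFun ζ
  map_add' ζ ζ' := by
    refine LinearMap.ext fun η => ?_
    obtain ⟨x, rfl⟩ := Omega.mk_surjective _ η
    obtain ⟨y, rfl⟩ := Omega.mk_surjective _ ζ
    obtain ⟨y', rfl⟩ := Omega.mk_surjective _ ζ'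
    change f ((x : SymAlg (ConjDual V)) * (y + y')) = f (x * y) + f (x * y')
    rw [mul_add, map_add]
  map_smul' c ζ := by
    refine LinearMap.ext fun η => ?_
    obtain ⟨x, rfl⟩ := Omega.mk_surjective _ η
    obtain ⟨y, rfl⟩ := Omega.mk_surjective _ ζ
    change f ((x : SymAlg (ConjDual V)) * (c • (y : SymAlg (ConjDual V)))) = c • f (x * y)
    rw [mul_smul_comm, map_smul]

theorem IsTopForm.pairing_apply (η : Omega V k) (ζ : Omega V l) :
    hf.pairing ζ η = hf.topVal (RSpace.mul η ζ) := rfl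

theorem IsTopForm.pairing_mk (x : symPow (ConjDual V) k) (y : symPow (ConjDual V) l) :
    hf.pairing (Omega.mk l y) (Omega.mk k x) = f (x * y) := rfl

/-- The product of the two classes is the product of the `k + l = n` squares of the concatenated
family. -/
theorem IsTopForm.pairing_sqProd_nonneg (w : Fin k → ConjDual V) (w' : Fin l → ConjDual V) :
    0 ≤ hf.pairing (sqProd w') (sqProd w) := by
  rw [sqProd, sqProd, pairing_mk]
  have h := hf.prod_nonneg (Fin.append w w')
  rwa [Fin.prod_univ_add, Finset.prod_congr rfl fun i _ => by rw [Fin.append_left],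
    Finset.prod_congr (s₁ := (Finset.univ : Finset (Fin l))) rfl fun i _ => by
      rw [Fin.append_right]] at h

theorem IsTopForm.eq_zero_of_pairing {η : Omega V k} (h : ∀ ζ, hf.pairing ζ η = 0) : η = 0 := by
  obtain ⟨x, rfl⟩ := Omega.mk_surjective _ η
  exact (Submodule.Quotient.mk_eq_zero _).2
    ((hf.mem_leftKernel rfl x).2 fun y => h (Omega.mk l y))

end Complementary

end Pairing

/-! ### Positive elements -/

section Positivity

variable {V : Type u} [AddCommGroup V] [Module ℍ[ℝ]ᵐᵒᵖ V]

theorem exists_isTopForm {W : Type u} [AddCommGroup W] [Module ℝ W] [Module ℍ[ℝ]ᵐᵒᵖ W]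
    [IsScalarTower ℝ ℍ[ℝ]ᵐᵒᵖ W] {n : ℕ} (e : Module.Basis (Fin n) ℍ[ℝ]ᵐᵒᵖ W) :
    ∃ f : SymAlg W →ₗ[ℝ] ℝ, IsTopForm e f := by
  obtain ⟨f, h1, h2⟩ := exists_topForm e
  exact ⟨f, h1, h2⟩

theorem linearIndependent_coordForm {n : ℕ} (b : Module.Basis (Fin n) ℍ[ℝ]ᵐᵒᵖ V) :
    LinearIndependent ℍ[ℝ]ᵐᵒᵖ (coordForm b) := by
  have h := (coordBasis b).linearIndependent
  rwa [show ⇑(coordBasis b) = coordForm b from funext (coordBasis_apply b)] at h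

theorem idPow_eq {n : ℕ} (b : Module.Basis (Fin n) ℍ[ℝ]ᵐᵒᵖ V) (m : ℕ) :
    idPow b m = ∑ p : Fin m → Fin n, sqProd fun i => coordForm b (p i) := by
  have h : (⟨SymmetricAlgebra.ι ℝ (sigmaFixed (ConjDual V)) (matrixForm b (HypHerm.id n)) ^ m,
      Submodule.pow_mem_pow _ (LinearMap.mem_range_self _ _) m⟩ : symPow (ConjDual V) m) =
      ∑ p : Fin m → Fin n, ⟨∏ i, sqElt (coordForm b (p i)),
        prod_sqElt_mem fun i => coordForm b (p i)⟩ := by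
    refine Subtype.ext ?_
    rw [Submodule.coe_sum]
    change _ ^ m = ∑ p : Fin m → Fin n, ∏ i, sqElt (coordForm b (p i))
    rw [ι_matrixForm_id, Fintype.sum_pow]
  rw [idPow, h, map_sum]
  rfl

section Top

variable {n : ℕ} {e : Module.Basis (Fin n) ℍ[ℝ]ᵐᵒᵖ (ConjDual V)}
  {f : SymAlg (ConjDual V) →ₗ[ℝ] ℝ}

theorem IsTopForm.topVal_sqProd (hf : IsTopForm e f) (w : Fin n → ConjDual V) :
    hf.topVal (sqProd w) = f (∏ i, sqElt (w i)) := rfl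

/-- In the expansion of `(∑ [φ_i ⊗ φ_i])^n` all terms are non-negative, and the one with every index
once is positive. So the half line does not depend on the basis. -/
theorem IsTopForm.topVal_idPow_pos (hf : IsTopForm e f) (b : Module.Basis (Fin n) ℍ[ℝ]ᵐᵒᵖ V) :
    0 < hf.topVal (idPow b n) := by
  rw [idPow_eq, map_sum]
  refine Finset.sum_pos' (fun p _ => hf.prod_nonneg _) ⟨fun i => i, Finset.mem_univ _, ?_⟩
  exact hf.prod_pos (linearIndependent_coordForm b)

theorem IsTopForm.mem_topNonneg (hf : IsTopForm e f) (b : Module.Basis (Fin n) ℍ[ℝ]ᵐᵒᵖ V)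
    {ω : Omega V n} : ω ∈ topNonneg V n ↔ 0 ≤ hf.topVal ω := by
  constructor
  · rintro ⟨b', t, ht, rfl⟩
    rw [map_smul]
    exact mul_nonneg ht (hf.topVal_idPow_pos b').le
  · intro h
    have hpos := hf.topVal_idPow_pos b
    refine ⟨b, hf.topVal ω / hf.topVal (idPow b n), by positivity, hf.topVal_injective ?_⟩
    rw [map_smul, smul_eq_mul, div_mul_cancel₀ _ hpos.ne']

end Top

/-- The pullback in top degree: `f^* ξ` is a multiple of the product of the squares of the pulled
back coordinates. -/
theorem mk_symPowMap_conjDualMap {k l : ℕ} (b : Module.Basis (Fin (k + l)) ℍ[ℝ]ᵐᵒᵖ V)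
    {U : Type u} [AddCommGroup U] [Module ℍ[ℝ]ᵐᵒᵖ U] (b' : Module.Basis (Fin k) ℍ[ℝ]ᵐᵒᵖ U)
    {f' : SymAlg (ConjDual U) →ₗ[ℝ] ℝ} (hf' : IsTopForm (coordBasis b') f')
    (g : V →ₗ[ℍ[ℝ]ᵐᵒᵖ] U) (x : symPow (ConjDual U) k) :
    Omega.mk k (symPowMap (conjDualMap g) k x) =
      hf'.topVal (Omega.mk k x) • sqProd fun i => conjDualMap g (coordForm b' i) := by
  obtain ⟨f, hf⟩ := exists_isTopForm (coordBasis b)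
  rw [hf'.topVal_mk, sqProd, ← map_smul, ← sub_eq_zero, ← map_sub]
  refine (Submodule.Quotient.mk_eq_zero _).2 ((hf.mem_leftKernel rfl _).2 fun y => ?_)
  -- On `U` the representative differs from its multiple of the product of squares by cross terms,
  -- whose pullback pairs to zero with everything.
  have h := hf.map_crossSpan_eq_zero (conjDualMap g) (hf'.sub_mem_crossSpan x.2) y
  rw [map_sub, map_smul, map_prod] at h
  simp only [symAlgMap_sqElt, coordBasis_apply] at h
  exact h

/-- Take `U = ℍ^k` and the morphism with components `w i`; `ULift` only adjusts the universe. -/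
theorem exists_linearMap_conjDualMap {k : ℕ} (w : Fin k → ConjDual V) :
    ∃ (U : Type u) (_ : AddCommGroup U) (_ : Module ℍ[ℝ]ᵐᵒᵖ U)
      (b' : Module.Basis (Fin k) ℍ[ℝ]ᵐᵒᵖ U) (g : V →ₗ[ℍ[ℝ]ᵐᵒᵖ] U),
      ∀ i, conjDualMap g (coordForm b' i) = w i := by
  refine ⟨ULift.{u} (Fin k → ℍ[ℝ]ᵐᵒᵖ), inferInstance, inferInstance,
    (Pi.basisFun ℍ[ℝ]ᵐᵒᵖ (Fin k)).map ULift.moduleEquiv.symm,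
    ULift.moduleEquiv.symm.toLinearMap ∘ₗ LinearMap.pi fun i =>
      { toFun := fun v => op ((w i).eval v)
        map_add' := fun x y => congrArg op (map_add (show V →ₗ[ℍ[ℝ]ᵐᵒᵖ] ℍ[ℝ] from w i) x y)
        map_smul' := fun q x => by
          rw [ConjDual.eval_vec_smul, op_mul, op_unop]
          rfl }, fun i => ?_⟩
  refine ConjDual.ext fun v => ?_
  change unop (((Pi.basisFun ℍ[ℝ]ᵐᵒᵖ (Fin k)).map ULift.moduleEquiv.symm).repr _ i) = _
  simp

theorem mem_simplePositive {k l : ℕ} (b : Module.Basis (Fin (k + l)) ℍ[ℝ]ᵐᵒᵖ V) {η : Omega V k} :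
    η ∈ simplePositive V k ↔
      ∃ (t : ℝ) (w : Fin k → ConjDual V), 0 ≤ t ∧ η = t • sqProd w := by
  constructor
  · rintro ⟨U, _, _, _, g, ξ, -, ⟨b', t, ht, rfl⟩, x, hx, rfl⟩
    obtain ⟨f', hf'⟩ := exists_isTopForm (coordBasis b')
    refine ⟨_, _, ?_, mk_symPowMap_conjDualMap b b' hf' g x⟩
    rw [hx, map_smul]
    exact mul_nonneg ht (hf'.topVal_idPow_pos b').le
  · rintro ⟨t, w, ht, rfl⟩
    obtain ⟨U, _, _, b', g, hg⟩ := exists_linearMap_conjDualMap w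
    obtain ⟨f', hf'⟩ := exists_isTopForm (coordBasis b')
    have hpos := hf'.topVal_idPow_pos b'
    -- The multiple of `[Id]^k` is scaled to have value `t` under the top form of `U`.
    obtain ⟨x, hx⟩ := Omega.mk_surjective k ((t / hf'.topVal (idPow b' k)) • idPow b' k)
    refine ⟨U, _, _, Module.Finite.of_basis b', g, _, by simp [Module.finrank_eq_card_basis b'],
      ⟨b', _, by positivity, rfl⟩, x, hx, ?_⟩
    rw [mk_symPowMap_conjDualMap b b' hf' g x, hx, map_smul, smul_eq_mul,
      div_mul_cancel₀ _ hpos.ne']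
    simp only [hg]

theorem strongCone_eq {k l : ℕ} (b : Module.Basis (Fin (k + l)) ℍ[ℝ]ᵐᵒᵖ V) :
    strongCone V k = (AddSubmonoid.closure
      {η | ∃ (t : ℝ) (w : Fin k → ConjDual V), 0 ≤ t ∧ η = t • sqProd w} : Set (Omega V k)) := by
  have h : simplePositive V k =
      {η | ∃ (t : ℝ) (w : Fin k → ConjDual V), 0 ≤ t ∧ η = t • sqProd w} :=
    Set.ext fun η => mem_simplePositive b
  rw [← h]
  rfl

theorem smul_sqProd_mem_strongCone {k l : ℕ} (b : Module.Basis (Fin (k + l)) ℍ[ℝ]ᵐᵒᵖ V) {t : ℝ}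
    (ht : 0 ≤ t) (w : Fin k → ConjDual V) : t • sqProd w ∈ strongCone V k := by
  rw [strongCone_eq b]
  exact AddSubmonoid.subset_closure ⟨t, w, ht, rfl⟩

/-- Induction principle for strongly positive elements. -/
theorem strongCone_induction {k l : ℕ} (b : Module.Basis (Fin (k + l)) ℍ[ℝ]ᵐᵒᵖ V)
    {p : Omega V k → Prop} (hsmul : ∀ (t : ℝ) (w : Fin k → ConjDual V), 0 ≤ t → p (t • sqProd w))
    (h0 : p 0) (hadd : ∀ x y, p x → p y → p (x + y)) {η : Omega V k} (hη : η ∈ strongCone V k) :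
    p η := by
  rw [strongCone_eq b] at hη
  induction hη using AddSubmonoid.closure_induction with
  | mem x hx =>
    obtain ⟨t, w, ht, rfl⟩ := hx
    exact hsmul t w ht
  | zero => exact h0
  | add x y _ _ hx hy => exact hadd x y hx hy

theorem mem_weakCone {k l : ℕ} (b : Module.Basis (Fin (k + l)) ℍ[ℝ]ᵐᵒᵖ V)
    {e : Module.Basis (Fin (k + l)) ℍ[ℝ]ᵐᵒᵖ (ConjDual V)} {f : SymAlg (ConjDual V) →ₗ[ℝ] ℝ}
    (hf : IsTopForm e f) {η : Omega V k} :
    η ∈ weakCone V k ↔ ∀ w : Fin l → ConjDual V, 0 ≤ hf.pairing (sqProd w) η := by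
  have hn : Module.finrank ℍ[ℝ]ᵐᵒᵖ V = k + l := by simp [Module.finrank_eq_card_basis b]
  -- The test elements live in degree `l`, so the two degrees exchange roles.
  have b₂ : Module.Basis (Fin (l + k)) ℍ[ℝ]ᵐᵒᵖ V := b.reindex (finCongr (add_comm k l))
  constructor
  · intro h w
    have h1 := h l hn.symm (sqProd w) (by
      have h2 := smul_sqProd_mem_strongCone b₂ zero_le_one w
      rwa [one_smul] at h2)
    exact (hf.mem_topNonneg b).1 h1
  · intro h l' hl' ζ hζ
    obtain rfl : l' = l := by omega
    refine (hf.mem_topNonneg b).2 ?_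
    rw [← hf.pairing_apply]
    refine strongCone_induction b₂ (p := fun ζ => 0 ≤ hf.pairing ζ η) (fun t w ht => ?_) ?_
      (fun x y hx hy => ?_) hζ
    · rw [map_smul, LinearMap.smul_apply]
      exact mul_nonneg ht (h w)
    · rw [map_zero, LinearMap.zero_apply]
    · rw [map_add, LinearMap.add_apply]
      exact add_nonneg hx hy

theorem strongCone_subset_weakCone {k l : ℕ} (b : Module.Basis (Fin (k + l)) ℍ[ℝ]ᵐᵒᵖ V) :
    strongCone V k ⊆ weakCone V k := by
  obtain ⟨f, hf⟩ := exists_isTopForm (coordBasis b)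
  intro η hη
  rw [mem_weakCone b hf]
  intro w
  refine strongCone_induction b (p := fun η => 0 ≤ hf.pairing (sqProd w) η) (fun t w' ht => ?_) ?_
    (fun x y hx hy => ?_) hη
  · rw [map_smul]
    exact mul_nonneg ht (hf.pairing_sqProd_nonneg w' w)
  · rw [map_zero]
  · rw [map_add]
    exact add_nonneg hx hy

/-! ### Degrees `0` and `n` -/

theorem weakCone_zero {n : ℕ} (b : Module.Basis (Fin n) ℍ[ℝ]ᵐᵒᵖ V) :
    weakCone V 0 = strongCone V 0 := by
  have b₀ : Module.Basis (Fin (0 + n)) ℍ[ℝ]ᵐᵒᵖ V := b.reindex (finCongr (zero_add n).symm)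
  refine subset_antisymm ?_ (strongCone_subset_weakCone b₀)
  obtain ⟨f, hf⟩ := exists_isTopForm (coordBasis b₀)
  intro η hη
  rw [mem_weakCone b₀ hf] at hη
  obtain ⟨⟨x, hx⟩, rfl⟩ := Omega.mk_surjective _ η
  have hx' := hx
  rw [symPow, pow_zero] at hx'
  obtain ⟨r, rfl⟩ := Submodule.mem_one.1 hx'
  -- Degree `0` consists of multiples of the empty product; the sign of `r` is then detected by
  -- pairing with the squares of a basis.
  have h1 : Omega.mk 0 (⟨algebraMap ℝ _ r, hx⟩ : symPow (ConjDual V) 0) =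
      r • sqProd (Fin.elim0 : Fin 0 → ConjDual V) := by
    rw [sqProd, ← map_smul]
    congr 1
    exact Subtype.ext (by simp [Algebra.algebraMap_eq_smul_one])
  rw [h1] at hη ⊢
  refine smul_sqProd_mem_strongCone b₀ ?_ _
  let c : Fin n → ConjDual V := fun i => coordForm b₀ (Fin.natAdd 0 i)
  have hc : 0 < hf.pairing (sqProd c) (sqProd (Fin.elim0 : Fin 0 → ConjDual V)) := by
    have h := hf.prod_pos (linearIndependent_coordForm b₀)
    rw [Fin.prod_univ_add] at h
    rw [sqProd, sqProd, hf.pairing_mk]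
    exact h
  have h2 := hη c
  rw [map_smul, smul_eq_mul] at h2
  exact nonneg_of_mul_nonneg_left h2 hc

theorem weakCone_top {n : ℕ} (b : Module.Basis (Fin n) ℍ[ℝ]ᵐᵒᵖ V) :
    weakCone V n = strongCone V n := by
  refine subset_antisymm ?_ (strongCone_subset_weakCone (l := 0) b)
  obtain ⟨f, hf⟩ := exists_isTopForm (coordBasis b)
  intro η hη
  rw [mem_weakCone (l := 0) b hf] at hη
  have h0 : ∀ ω : Omega V n, hf.pairing (k := n) (l := 0) (sqProd Fin.elim0) ω = hf.topVal ω := by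
    intro ω
    obtain ⟨x, rfl⟩ := Omega.mk_surjective _ ω
    rw [sqProd, hf.pairing_mk (l := 0), hf.topVal_mk]
    simp
  have h1 := hη Fin.elim0
  rw [h0] at h1
  have h2 : η = hf.topVal η • sqProd (coordForm b) := by
    apply hf.topVal_injective
    have h3 := hf.prod_basis
    simp only [coordBasis_apply] at h3
    rw [map_smul, hf.topVal_sqProd, h3, smul_eq_mul, mul_one]
  rw [h2]
  exact smul_sqProd_mem_strongCone (l := 0) b h1 _

end Positivity

/-! ### Degrees `1` and `n - 1` -/

section Codegree

variable {V : Type u} [AddCommGroup V] [Module ℍ[ℝ]ᵐᵒᵖ V]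

/-- Exchange `v` for a basis vector along which it has a nonzero coordinate. -/
theorem exists_basis_apply_eq {n : ℕ} (b : Module.Basis (Fin n) ℍ[ℝ]ᵐᵒᵖ V) {v : V} (hv : v ≠ 0) :
    ∃ (b' : Module.Basis (Fin n) ℍ[ℝ]ᵐᵒᵖ V) (i : Fin n), b' i = v := by
  have hfin : Module.Finite ℍ[ℝ]ᵐᵒᵖ V := Module.Finite.of_basis b
  have hn : Module.finrank ℍ[ℝ]ᵐᵒᵖ V = n := by simp [Module.finrank_eq_card_basis b]
  have hne : b.repr v ≠ 0 := by simpa using hv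
  obtain ⟨i, hi⟩ := Finsupp.ne_iff.1 hne
  have hli := linearIndependent_update hn b.linearIndependent (c := b.repr v) (i := i) hi
  rw [b.sum_repr] at hli
  have hspan := hli.span_eq_top_of_card_eq_finrank' (by simp [hn])
  exact ⟨Module.Basis.mk hli hspan.ge, i, by rw [Module.Basis.mk_apply, Function.update_self]⟩

/-- For `v ≠ 0` there is a product of `n - 1` squares whose pairing with a hyperhermitian form is
a positive multiple of the value of the form at `v`. -/
theorem IsTopForm.exists_prod_eq_evalForm {k n : ℕ} (hkn : k + 1 = n)
    {e : Module.Basis (Fin n) ℍ[ℝ]ᵐᵒᵖ (ConjDual V)} {f : SymAlg (ConjDual V) →ₗ[ℝ] ℝ}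
    (hf : IsTopForm e f) (b : Module.Basis (Fin n) ℍ[ℝ]ᵐᵒᵖ V) {v : V} (hv : v ≠ 0) :
    ∃ (w : Fin k → ConjDual V) (c : ℝ), 0 < c ∧ ∀ t : sigmaFixed (ConjDual V),
      f (SymmetricAlgebra.ι ℝ _ t * ∏ i, sqElt (w i)) = c * evalForm v t := by
  subst hkn
  obtain ⟨b', i, rfl⟩ := exists_basis_apply_eq b hv
  -- With `v` as the `i`-th basis vector, multiply by the squares of the other coordinates. For `[φ
  -- ⊗ φ]` only the `i`-th coordinate of `φ`, of norm `|φ(v)|`, survives; the rest are cross terms.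
  refine ⟨fun j => coordForm b' (i.succAbove j), f (∏ j, sqElt (coordForm b' j)),
    hf.prod_pos (linearIndependent_coordForm b'), fun t => ?_⟩
  have hprod : ∏ j, sqElt (coordForm b' (i.succAbove j)) =
      ∏ j ∈ Finset.univ.erase i, sqElt (coordForm b' j) := by
    rw [Fin.univ_succAbove _ i, Finset.erase_cons, Finset.prod_map]
    rfl
  have ht : t ∈ Submodule.span ℝ (Set.range (sqTensor (W := ConjDual V))) := by
    rw [span_range_sqTensor]
    trivial
  induction ht using Submodule.span_induction with
  | mem t ht =>
    obtain ⟨φ, rfl⟩ := ht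
    have h := sqElt_sum_mul_prod (coordForm b') (fun j => op (star (φ.eval (b' j)))) i
    rw [← eq_sum_coordForm] at h
    have h' := congrArg f h
    rw [map_sub, map_smul, map_smul, map_sum, Finset.sum_eq_zero, smul_zero, sub_eq_zero] at h'
    · rw [hprod, evalForm_sqTensor]
      refine h'.trans ?_
      rw [unop_op, Quaternion.normSq_star, smul_eq_mul, mul_comm]
    · intro j hj
      have h0 := hf.cross_prod _ (coordForm b') (op (star (φ.eval (b' i))) • coordForm b' i + φ)
        (op (star (φ.eval (b' j)))) hj 1
      rwa [mul_one] at h0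
  | zero => simp
  | add x y _ _ hx hy => rw [map_add, add_mul, map_add, hx, hy, Submodule.coe_add, map_add, mul_add]
  | smul r x _ hx =>
    rw [map_smul, smul_mul_assoc, map_smul, hx, Submodule.coe_smul, map_smul, smul_eq_mul,
      smul_eq_mul, mul_left_comm]

/-- The vector with given coordinates. -/
theorem coordForm_eval_sum {n : ℕ} (b : Module.Basis (Fin n) ℍ[ℝ]ᵐᵒᵖ V) (x : Fin n → ℍ[ℝ])
    (i : Fin n) : (coordForm b i).eval (∑ j, op (x j) • b j) = x i := by
  rw [coordForm_eval, b.repr_sum_self fun j => op (x j), unop_op]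

theorem IsTopForm.exists_prod_eq_form {k n : ℕ} (hkn : k + 1 = n)
    {e : Module.Basis (Fin n) ℍ[ℝ]ᵐᵒᵖ (ConjDual V)} {f : SymAlg (ConjDual V) →ₗ[ℝ] ℝ}
    (hf : IsTopForm e f) (b : Module.Basis (Fin n) ℍ[ℝ]ᵐᵒᵖ V) {x : Fin n → ℍ[ℝ]} (hx : x ≠ 0) :
    ∃ (w : Fin k → ConjDual V) (c : ℝ), 0 < c ∧ ∀ A : HypHerm n,
      f (SymmetricAlgebra.ι ℝ _ (matrixForm b A) * ∏ i, sqElt (w i)) =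
        c * (HypHerm.form A x x).re := by
  have hv : ∑ j, op (x j) • b j ≠ 0 := by
    intro h
    refine hx (funext fun i => ?_)
    have h1 := coordForm_eval_sum b x i
    rw [h] at h1
    rw [← h1, coordForm_eval, map_zero]
    rfl
  obtain ⟨w, c, hc, h⟩ := hf.exists_prod_eq_evalForm hkn b hv
  refine ⟨w, c, hc, fun A => ?_⟩
  rw [h, evalForm_matrixForm]
  simp only [coordForm_eval_sum]

theorem ι_mem_symPow_one (t : sigmaFixed (ConjDual V)) :
    SymmetricAlgebra.ι ℝ _ t ∈ symPow (ConjDual V) 1 := by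
  rw [symPow, pow_one]
  exact LinearMap.mem_range_self _ t

theorem matrixToOmega_apply {n : ℕ} (b : Module.Basis (Fin n) ℍ[ℝ]ᵐᵒᵖ V) (A : HypHerm n) :
    matrixToOmega b A =
      Omega.mk 1 ⟨SymmetricAlgebra.ι ℝ _ (matrixForm b A), ι_mem_symPow_one _⟩ := rfl

theorem sqProd_one {n : ℕ} (b : Module.Basis (Fin n) ℍ[ℝ]ᵐᵒᵖ V) (w : Fin 1 → ConjDual V) :
    sqProd w = matrixToOmega b (HypHerm.rankOne fun i => star ((w 0).eval (b i))) := by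
  rw [sqProd, matrixToOmega_apply]
  congr 1
  refine Subtype.ext ?_
  change ∏ i, sqElt (w i) = _
  rw [← sqTensor_eq_matrixForm, Fin.prod_univ_one, sqElt]

theorem matrixToOmega_rankOne {n : ℕ} (b : Module.Basis (Fin n) ℍ[ℝ]ᵐᵒᵖ V) (x : Fin n → ℍ[ℝ]) :
    matrixToOmega b (HypHerm.rankOne x) =
      sqProd fun _ : Fin 1 => ∑ i, op (x i) • coordForm b i := by
  rw [sqProd_one b]
  simp only [eval_sum_smul_coordForm, unop_op, star_star]

theorem matrixToOmega_surjective {n : ℕ} (b : Module.Basis (Fin n) ℍ[ℝ]ᵐᵒᵖ V) :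
    Function.Surjective (matrixToOmega b) := by
  intro η
  obtain ⟨⟨x, hx⟩, rfl⟩ := Omega.mk_surjective _ η
  have hx' := hx
  rw [symPow, pow_one] at hx'
  obtain ⟨t, rfl⟩ := hx'
  obtain ⟨A, rfl⟩ := matrixForm_surjective b t
  exact ⟨A, rfl⟩

theorem pairing_matrixToOmega {l : ℕ} {e : Module.Basis (Fin (1 + l)) ℍ[ℝ]ᵐᵒᵖ (ConjDual V)}
    {f : SymAlg (ConjDual V) →ₗ[ℝ] ℝ} (hf : IsTopForm e f)
    (b : Module.Basis (Fin (1 + l)) ℍ[ℝ]ᵐᵒᵖ V) (A : HypHerm (1 + l)) (w : Fin l → ConjDual V) :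
    hf.pairing (sqProd w) (matrixToOmega b A) =
      f (SymmetricAlgebra.ι ℝ _ (matrixForm b A) * ∏ i, sqElt (w i)) := rfl

/-- The values of the form are recovered from its pairings with products of squares, and they
determine the matrix. -/
theorem matrixToOmega_injective {l : ℕ} (b : Module.Basis (Fin (1 + l)) ℍ[ℝ]ᵐᵒᵖ V) :
    Function.Injective (matrixToOmega b) := by
  obtain ⟨f, hf⟩ := exists_isTopForm (coordBasis b)
  rw [injective_iff_map_eq_zero]
  intro A hA
  refine HypHerm.eq_zero_of_form fun x => ?_
  rcases eq_or_ne x 0 with rfl | hx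
  · simp [HypHerm.form]
  · obtain ⟨w, c, hc, h⟩ := hf.exists_prod_eq_form (add_comm l 1) b hx
    have h1 := h A
    rw [← pairing_matrixToOmega hf, hA, map_zero] at h1
    exact (mul_eq_zero.1 h1.symm).resolve_left hc.ne'

theorem image_nonnegCone_eq_strongCone {l : ℕ} (b : Module.Basis (Fin (1 + l)) ℍ[ℝ]ᵐᵒᵖ V) :
    matrixToOmega b '' nonnegCone (1 + l) = strongCone V 1 := by
  refine subset_antisymm ?_ fun η hη => ?_
  · rintro _ ⟨A, hA, rfl⟩
    have hA' := HypHerm.mem_closure_rankOne hA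
    clear hA
    rw [strongCone_eq b]
    induction hA' using AddSubmonoid.closure_induction with
    | mem A hA =>
      obtain ⟨x, rfl⟩ := hA
      refine AddSubmonoid.subset_closure
        ⟨1, fun _ => ∑ i, op (x i) • coordForm b i, zero_le_one, ?_⟩
      rw [one_smul, matrixToOmega_rankOne]
    | zero =>
      rw [map_zero]
      exact zero_mem _
    | add A B _ _ hA hB =>
      rw [map_add]
      exact add_mem hA hB
  · refine strongCone_induction b (p := fun η => η ∈ matrixToOmega b '' nonnegCone (1 + l))
      (fun t w ht => ?_) ⟨0, HypHerm.zero_mem_nonnegCone, map_zero _⟩ ?_ hη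
    · exact ⟨_, HypHerm.smul_mem_nonnegCone ht (HypHerm.rankOne_mem _), by
        rw [map_smul, ← sqProd_one]⟩
    · rintro _ _ ⟨A, hA, rfl⟩ ⟨B, hB, rfl⟩
      exact ⟨A + B, HypHerm.add_mem_nonnegCone hA hB, map_add _ _ _⟩

theorem image_nonnegCone_eq_weakCone {l : ℕ} (b : Module.Basis (Fin (1 + l)) ℍ[ℝ]ᵐᵒᵖ V) :
    matrixToOmega b '' nonnegCone (1 + l) = weakCone V 1 := by
  refine subset_antisymm ?_ fun η hη => ?_
  · rw [image_nonnegCone_eq_strongCone]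
    exact strongCone_subset_weakCone b
  · obtain ⟨f, hf⟩ := exists_isTopForm (coordBasis b)
    rw [mem_weakCone b hf] at hη
    obtain ⟨A, rfl⟩ := matrixToOmega_surjective b η
    refine ⟨A, HypHerm.mem_nonnegCone.2 fun x => ?_, rfl⟩
    rcases eq_or_ne x 0 with rfl | hx
    · simp [HypHerm.form]
    · obtain ⟨w, c, hc, h⟩ := hf.exists_prod_eq_form (add_comm l 1) b hx
      have h1 := hη w
      rw [pairing_matrixToOmega, h] at h1
      exact nonneg_of_mul_nonneg_right h1 hc

/-! ### Degree `n - 1` through the trace form -/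

section Dual

variable {k : ℕ} (b : Module.Basis (Fin (k + 1)) ℍ[ℝ]ᵐᵒᵖ V)
  {e : Module.Basis (Fin (k + 1)) ℍ[ℝ]ᵐᵒᵖ (ConjDual V)} {f : SymAlg (ConjDual V) →ₗ[ℝ] ℝ}
  (hf : IsTopForm e f)

/-- The isomorphism `Ω^{n,n}(V) ≃ ℝ` with `[Id]^n ↦ 1`. -/
def IsTopForm.topEquiv : Omega V (k + 1) ≃ₗ[ℝ] ℝ :=
  LinearEquiv.ofBijective ((hf.topVal (idPow b (k + 1)))⁻¹ • hf.topVal) (by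
    have hpos := hf.topVal_idPow_pos b
    constructor
    · intro x y hxy
      exact hf.topVal_injective (mul_left_cancel₀ (inv_ne_zero hpos.ne') hxy)
    · intro r
      refine ⟨r • idPow b (k + 1), ?_⟩
      rw [map_smul, LinearMap.smul_apply, smul_eq_mul, smul_eq_mul, inv_mul_cancel₀ hpos.ne',
        mul_one])

theorem IsTopForm.topEquiv_apply (ω : Omega V (k + 1)) :
    hf.topEquiv b ω = (hf.topVal (idPow b (k + 1)))⁻¹ * hf.topVal ω := rfl

/-- The map `Ω^{n-1,n-1}(V) → ℋ_n` dual to `A ↦ [A]` with respect to the trace form. -/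
def IsTopForm.toMatrix : Omega V k →ₗ[ℝ] HypHerm (k + 1) :=
  ((HypHerm.traceBilin (k + 1)).toDual (HypHerm.traceBilin_nondegenerate (k + 1))).symm.toLinearMap ∘ₗ
    ((hf.topVal (idPow b (k + 1)))⁻¹ • (hf.pairing.compl₁₂ (matrixToOmega b) LinearMap.id).flip)

theorem IsTopForm.traceForm_toMatrix (η : Omega V k) (X : HypHerm (k + 1)) :
    traceForm (hf.toMatrix b η) X =
      (hf.topVal (idPow b (k + 1)))⁻¹ * hf.pairing (matrixToOmega b X) η := by
  rw [← HypHerm.traceBilin_apply, toMatrix, LinearMap.comp_apply, LinearEquiv.coe_coe,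
    LinearMap.BilinForm.apply_toDual_symm_apply]
  rfl

/-- A zero matrix means zero pairing with all of `Ω^{1,1}`, and the quotient by `L^k` has made the
pairing nondegenerate. -/
theorem IsTopForm.toMatrix_injective : Function.Injective (hf.toMatrix b) := by
  have hpos := hf.topVal_idPow_pos b
  rw [injective_iff_map_eq_zero]
  intro η hη
  refine hf.eq_zero_of_pairing fun ζ => ?_
  obtain ⟨X, rfl⟩ := matrixToOmega_surjective b ζ
  have h := hf.traceForm_toMatrix b η X
  rw [hη, ← HypHerm.traceBilin_apply, map_zero, LinearMap.zero_apply] at h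
  exact (mul_eq_zero.1 h.symm).resolve_left (inv_ne_zero hpos.ne')

theorem IsTopForm.toMatrix_mem_nonnegCone {η : Omega V k} (hη : η ∈ weakCone V k) :
    hf.toMatrix b η ∈ nonnegCone (k + 1) := by
  have hpos := hf.topVal_idPow_pos b
  rw [mem_weakCone b hf] at hη
  rw [HypHerm.mem_nonnegCone]
  intro x
  rw [← HypHerm.traceForm_rankOne, traceForm_toMatrix, matrixToOmega_rankOne]
  exact mul_nonneg (by positivity) (hη _)

/-- The product of squares that evaluates forms at `x` represents the functional `X ↦ Re x^* X x =
(X, x x^*)`, up to a positive factor. -/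
theorem IsTopForm.exists_toMatrix_eq_rankOne (x : Fin (k + 1) → ℍ[ℝ]) :
    ∃ η ∈ strongCone V k, hf.toMatrix b η = HypHerm.rankOne x := by
  have hpos := hf.topVal_idPow_pos b
  rcases eq_or_ne x 0 with rfl | hx
  · refine ⟨0, zero_mem (AddSubmonoid.closure (simplePositive V k)), ?_⟩
    rw [map_zero]
    refine Subtype.ext (Matrix.ext fun i j => ?_)
    rw [HypHerm.rankOne_apply, Pi.zero_apply, zero_mul]
    rfl
  · obtain ⟨w, c, hc, h⟩ := hf.exists_prod_eq_form rfl b hx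
    -- The factor cancels both `c` and the normalization `[Id]^n ↦ 1`.
    refine ⟨(hf.topVal (idPow b (k + 1)) / c) • sqProd w,
      smul_sqProd_mem_strongCone b (by positivity) w, ?_⟩
    rw [← sub_eq_zero]
    refine (HypHerm.traceBilin_nondegenerate (k + 1)).1 _ fun X => ?_
    have h1 : hf.pairing (matrixToOmega b X) (sqProd w) = c * (HypHerm.form X x x).re := by
      rw [← h X, mul_comm]
      rfl
    rw [map_sub, LinearMap.sub_apply, HypHerm.traceBilin_apply, HypHerm.traceBilin_apply, traceForm_toMatrix,
      map_smul, h1, HypHerm.traceForm_comm, HypHerm.traceForm_rankOne, smul_eq_mul]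
    field_simp
    ring

theorem IsTopForm.toMatrix_image_strongCone :
    hf.toMatrix b '' strongCone V k = nonnegCone (k + 1) := by
  refine subset_antisymm ?_ fun A hA => ?_
  · rintro _ ⟨η, hη, rfl⟩
    exact hf.toMatrix_mem_nonnegCone b (strongCone_subset_weakCone b hη)
  · have hA' := HypHerm.mem_closure_rankOne hA
    clear hA
    induction hA' using AddSubmonoid.closure_induction with
    | mem A hA =>
      obtain ⟨x, rfl⟩ := hA
      exact hf.exists_toMatrix_eq_rankOne b x
    | zero => exact ⟨0, zero_mem (AddSubmonoid.closure (simplePositive V k)), map_zero _⟩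
    | add A B _ _ hA hB =>
      obtain ⟨η, hη, rfl⟩ := hA
      obtain ⟨ζ, hζ, rfl⟩ := hB
      exact ⟨η + ζ, (AddSubmonoid.closure (simplePositive V k)).add_mem hη hζ, map_add _ _ _⟩

theorem IsTopForm.toMatrix_image_weakCone :
    hf.toMatrix b '' weakCone V k = nonnegCone (k + 1) := by
  refine subset_antisymm ?_ ?_
  · rintro _ ⟨η, hη, rfl⟩
    exact hf.toMatrix_mem_nonnegCone b hη
  · rw [← hf.toMatrix_image_strongCone b]
    exact Set.image_mono (strongCone_subset_weakCone b)

/-- The range contains every `x x^*`. A functional vanishing on it corresponds under the trace form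
to a matrix whose hyperhermitian form is zero. -/
theorem IsTopForm.toMatrix_surjective : Function.Surjective (hf.toMatrix b) := by
  rw [← LinearMap.range_eq_top]
  by_contra hne
  obtain ⟨g, hg, hle⟩ := Submodule.exists_le_ker_of_lt_top _ (lt_top_iff_ne_top.2 hne)
  refine hg ?_
  set D := (HypHerm.traceBilin (k + 1)).toDual (HypHerm.traceBilin_nondegenerate (k + 1)) with hD
  suffices h : D.symm g = 0 by rwa [LinearEquiv.map_eq_zero_iff] at h
  refine HypHerm.eq_zero_of_form fun x => ?_
  obtain ⟨η, -, hη⟩ := hf.exists_toMatrix_eq_rankOne b x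
  have h := hle ⟨η, hη⟩
  rwa [LinearMap.mem_ker, ← LinearMap.BilinForm.apply_toDual_symm_apply
    (hB := HypHerm.traceBilin_nondegenerate (k + 1)), HypHerm.traceBilin_apply, HypHerm.traceForm_rankOne] at h

/-- The isomorphism `Ω^{n-1,n-1}(V) ≃ ℋ_n`. -/
def IsTopForm.matrixEquiv : Omega V k ≃ₗ[ℝ] HypHerm (k + 1) :=
  LinearEquiv.ofBijective (hf.toMatrix b) ⟨hf.toMatrix_injective b, hf.toMatrix_surjective b⟩

end Dual

/-- Both cones have the same image under an injective map. -/
theorem weakCone_eq_strongCone_of_succ {k : ℕ} (b : Module.Basis (Fin (k + 1)) ℍ[ℝ]ᵐᵒᵖ V) :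
    weakCone V k = strongCone V k := by
  obtain ⟨f, hf⟩ := exists_isTopForm (coordBasis b)
  refine (hf.toMatrix_injective b).image_injective ?_
  rw [hf.toMatrix_image_strongCone, hf.toMatrix_image_weakCone]

end Codegree

end QuatForms

end

/-! ### Assembly of the four statements -/

theorem proposition2p2p4 {V : Type u} [AddCommGroup V] [Module ℍ[ℝ]ᵐᵒᵖ V]
    [Module.Finite ℍ[ℝ]ᵐᵒᵖ V] (n : ℕ) (hn : Module.finrank ℍ[ℝ]ᵐᵒᵖ V = n) :
    -- the two cones coincide in the degrees `0, 1, n - 1, n`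
    (∀ k : ℕ, k ≤ n → (k = 0 ∨ k = 1 ∨ k + 1 = n ∨ k = n) → weakCone V k = strongCone V k) ∧
    -- the cone of non-negative hyperhermitian matrices is self-dual
    (nonnegCone n = {X : HypHerm n | ∀ Y ∈ nonnegCone n, 0 ≤ traceForm X Y}) ∧
    -- degree `1`: identification with hyperhermitian matrices through any basis of `V`
    (1 ≤ n → ∀ b : Module.Basis (Fin n) ℍ[ℝ]ᵐᵒᵖ V,
      Function.Bijective (matrixToOmega b) ∧
      matrixToOmega b '' nonnegCone n = strongCone V 1 ∧
      matrixToOmega b '' nonnegCone n = weakCone V 1) ∧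
    -- degree `n - 1`: `Ω^{n,n}(V) ≃ ℝ` with `(Id)^n ↦ 1`, and `Ω^{n-1,n-1}(V) ≃ (ℋ_n)^* ≃ ℋ_n`
    -- by the product with `Ω^{1,1}(V)` and the trace form
    (∀ k : ℕ, k + 1 = n → ∀ b : Module.Basis (Fin n) ℍ[ℝ]ᵐᵒᵖ V,
      ∃ (τ : Omega V (k + 1) ≃ₗ[ℝ] ℝ) (Ψ : Omega V k ≃ₗ[ℝ] HypHerm n),
        τ (idPow b (k + 1)) = 1 ∧
        (∀ (η : Omega V k) (X : HypHerm n),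
          τ (RSpace.mul η (matrixToOmega b X)) = traceForm (Ψ η) X) ∧
        Ψ '' strongCone V k = nonnegCone n ∧
        Ψ '' weakCone V k = nonnegCone n) := by
  have b : Module.Basis (Fin n) ℍ[ℝ]ᵐᵒᵖ V := Module.finBasisOfFinrankEq _ _ hn
  refine ⟨?_, ?_, ?_, ?_⟩
  · rintro k hkn (rfl | rfl | rfl | rfl)
    · exact weakCone_zero b
    · obtain ⟨l, rfl⟩ := Nat.exists_eq_add_of_le hkn
      rw [← image_nonnegCone_eq_weakCone b, image_nonnegCone_eq_strongCone b]
    · exact weakCone_eq_strongCone_of_succ b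
    · exact weakCone_top b
  · exact Set.ext fun X => HypHerm.mem_nonnegCone_iff_traceForm
  · intro h1 b
    obtain ⟨l, rfl⟩ := Nat.exists_eq_add_of_le h1
    exact ⟨⟨matrixToOmega_injective b, matrixToOmega_surjective b⟩,
      image_nonnegCone_eq_strongCone b, image_nonnegCone_eq_weakCone b⟩
  · rintro k rfl b
    obtain ⟨f, hf⟩ := exists_isTopForm (coordBasis b)
    refine ⟨hf.topEquiv b, hf.matrixEquiv b, ?_, fun η X => ?_, hf.toMatrix_image_strongCone b,
      hf.toMatrix_image_weakCone b⟩
    · rw [hf.topEquiv_apply, inv_mul_cancel₀ (hf.topVal_idPow_pos b).ne']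
    · rw [hf.topEquiv_apply]
      exact (hf.traceForm_toMatrix b η X).symm
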